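/- Let $n\in\mathbb N$ and $p\in\mathbb R$. All quantum systems are finite dimensional, and $\oplus$ is the bitwise XOR. *Encodings.* A quantum encoding of $x_0,x_1\in\{0,1\}^n$ consists of a probability distribution $\pi$ on the pairs $(x_0,x_1)$ and a density operator $\rho_{x_0,x_1}$ for each pair. For a function $f(x_0,x_1)$ with values in $\{0,1\}^n$, a measurement (POVM) $D=\{D_s\}_{s\in\{0,1\}^n}$ learns $f$ with probability $\sum_{x_0,x_1}\pi_{x_0,x_1}\operatorname{Tr}(D_{f(x_0,x_1)}\rho_{x_0,x_1})$; $\Pr[\text{learn } f]$ is the optimum of this over all $D$. The encoding hides the XOR if $\Pr[\text{learn } x_0\oplus x_1]=2^{-n}$. It can be decoded with average probability $p$ if there are measurements learning $x_0$ with some probability $p_0$ and $x_1$ with some probability $p_1$ such that $\frac12(p_0+p_1)=p$. *Oblivious transfer.* An $\mathrm{OT}^n_p$ protocol is an interactive two-party quantum protocol without inputs (private registers and a message register, initially in a product state up to Alice's first message, alternate unitaries, measurements at the end) in which Alice outputs $(z_0,z_1)\in\{0,1\}^n\times\{0,1\}^n$ or Abort, and Bob outputs $(b,w)\in\{0,1\}\times\{0,1\}^n$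 or Abort, such that, when both are honest, nobody aborts, $(z_0,z_1)$ is uniformly distributed, $b$ is uniformly distributed, and $w=z_b$ with probability $p$. It is non-interactive if the only communication is one message from Alice to Bob. It is secure if, for every strategy of a cheating Alice against honest Bob, Alice obtains no information about $b$ without Bob aborting, and, for every strategy of a cheating Bob against honest Alice, Bob obtains no information about $z_0\oplus z_1$ without Alice aborting. Here "no information about a secret that has $N$ possible values" is taken in either of two senses, the same one throughout the theorem: the probability that the cheater guesses the secret and the honest party does not abort is at most $\frac1N\Pr[\text{the honest party does not abort}]$ (conditional sense), or it is at most $\frac1N$ (absolute sense); $N=2$ for $b$ and $N=2^n$ for $z_0\oplus z_1$. *The game.* In $\mathrm{CHSH}_n$, Alice and Bob share an entangled state and do not communicate; Alice receives a uniformly random $x\in\{0,1\}^n$, Bob a uniformly random $y\in\{0,1\}$; they output $a,b\in\{0,1\}^n$ and win if $a_i\oplus b_i=y\,x_i$ for all $i$. **Theorem.** For either sense of security, the following are equivalent: 1. there is a quantum encoding of $x_0,x_1\in\{0,1\}^n$ that hides the XOR and can be decoded with average probability $p$; 2. there is a secure non-interactive $\mathrm{OT}^n_p$ protocol; 3. there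 is a secure $\mathrm{OT}^n_p$ protocol; 4. there is a quantum strategy that wins $\mathrm{CHSH}_n$ with probability $p$. Moreover, if $p\ge 2^{-n}$, then 2, 3 and 4 are also equivalent to 1'. there is a quantum encoding of $x_0,x_1\in\{0,1\}^n$ that hides the XOR and satisfies $\frac12\sum_{c\in\{0,1\}}\Pr[\text{learn } x_c]=p$, with the optimal decoding probabilities. -/

import Mathlib

open scoped BigOperators Kronecker ComplexOrder Matrix

noncomputable section

namespace QuantumXOR

/-- Bits; addition is XOR and multiplication is AND. -/
abbrev Bit : Type := ZMod 2

/-- Bit strings of length `n`; addition is the bitwise XOR. -/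
abbrev Str (n : ℕ) : Type := Fin n → Bit

/-- Pairs of strings `(x 0, x 1)`, indexed by a bit. -/
abbrev StrPair (n : ℕ) : Type := Bit → Str n

/-- A quantum measurement (POVM) with outcomes in `X` on the system `ℂ^H`. -/
structure POVM (H X : Type) [Fintype H] [DecidableEq H] [Fintype X] where
  op : X → Matrix H H ℂ
  posSemidef : ∀ x, (op x).PosSemidef
  sum_eq_one : ∑ x, op x = 1

/-! ### Quantum encodings of two strings -/

/-- A quantum encoding of two `n`-bit strings: a finite dimensional system, a prior distribution
on the pairs of strings, and a density operator for each pair. -/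
structure Encoding (n : ℕ) where
  H : Type
  [fintypeH : Fintype H]
  [decEqH : DecidableEq H]
  prior : StrPair n → ℝ
  prior_nonneg : ∀ x, 0 ≤ prior x
  prior_sum : ∑ x, prior x = 1
  state : StrPair n → Matrix H H ℂ
  state_posSemidef : ∀ x, (state x).PosSemidef
  state_trace : ∀ x, (state x).trace = 1

attribute [instance] Encoding.fintypeH Encoding.decEqH

namespace Encoding

variable {n : ℕ}

/-- The probability that the outcome of the measurement `D` on the encoding equals `f x`. -/
def successProb (E : Encoding n) (f : StrPair n → Str n) (D : POVM E.H (Str n)) : ℝ :=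
  ∑ x, E.prior x * ((D.op (f x) * E.state x).trace).re

/-- `Pr[learn f x]`: the optimum of the success probability over all measurements. -/
def learnProb (E : Encoding n) (f : StrPair n → Str n) : ℝ :=
  ⨆ D : POVM E.H (Str n), E.successProb f D

/-- The encoding hides the XOR: `x 0 ⊕ x 1` cannot be learnt better than by a blind guess of a
uniformly random string. -/
def HidesXOR (E : Encoding n) : Prop :=
  E.learnProb (fun x => x 0 + x 1) = (1 / 2 : ℝ) ^ n

/-- There are decoding procedures for `x 0` and for `x 1` whose average success probability
is `p`. -/
def DecodesWithAverage (E : Encoding n) (p : ℝ) : Prop :=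
  ∃ D : Bit → POVM E.H (Str n), (1 / 2 : ℝ) * ∑ c : Bit, E.successProb (fun x => x c) (D c) = p

/-- The average of the optimal decoding probabilities of `x 0` and `x 1`. -/
def optimalAverage (E : Encoding n) : ℝ :=
  (1 / 2 : ℝ) * ∑ c : Bit, E.learnProb (fun x => x c)

end Encoding

/-! ### The game -/

/-- A quantum strategy for `CHSH_n`: a shared entangled pure state of a bipartite finite
dimensional system, and a measurement for each question. -/
structure CHSHStrategy (n : ℕ) where
  A : Type
  B : Type
  [fintypeA : Fintype A]
  [decEqA : DecidableEq A]
  [fintypeB : Fintype B]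
  [decEqB : DecidableEq B]
  psi : A × B → ℂ
  psi_unit : star psi ⬝ᵥ psi = 1
  alice : Str n → POVM A (Str n)
  bob : Bit → POVM B (Str n)

attribute [instance] CHSHStrategy.fintypeA CHSHStrategy.decEqA CHSHStrategy.fintypeB
  CHSHStrategy.decEqB

namespace CHSHStrategy

variable {n : ℕ}

/-- The probability of the answers `a`, `b` on the questions `x`, `y`. -/
def answerProb (S : CHSHStrategy n) (x : Str n) (y : Bit) (a b : Str n) : ℝ :=
  (star S.psi ⬝ᵥ (((S.alice x).op a ⊗ₖ (S.bob y).op b) *ᵥ S.psi)).re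

/-- The probability of winning on uniformly random questions. -/
def winProb (S : CHSHStrategy n) : ℝ :=
  ∑ x : Str n, ∑ y : Bit, (1 / 2 : ℝ) ^ n * (1 / 2) *
    ∑ a : Str n, ∑ b : Str n,
      if ∀ i, a i + b i = y * x i then S.answerProb x y a b else 0

end CHSHStrategy

/-! ### Two-party quantum protocols

There is a private register for each party and a message register `M` that travels between them.
Alice prepares her register together with her first message. In each round Bob receives the message,
applies a unitary to it and his register and sends the message register back, and Alice does the
same. After the last round Bob holds the message register and his own, Alice holds hers, and both
measure. All intermediate measurements and decisions to abort are deferred to the end. -/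

/-- What Alice does up to the final measurement, honest or not. Only as many of the unitaries are
used as the protocol has rounds. -/
structure AliceStrategy (M : Type) [Fintype M] [DecidableEq M] where
  A : Type
  [fintypeA : Fintype A]
  [decEqA : DecidableEq A]
  init : A × M → ℂ
  init_unit : star init ⬝ᵥ init = 1
  act : ℕ → Matrix.unitaryGroup (A × M) ℂ

/-- What Bob does up to the final measurement, honest or not. -/
structure BobStrategy (M : Type) [Fintype M] [DecidableEq M] where
  B : Type
  [fintypeB : Fintype B]
  [decEqB : DecidableEq B]
  init : B → ℂ
  init_unit : star init ⬝ᵥ init = 1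
  act : ℕ → Matrix.unitaryGroup (M × B) ℂ

attribute [instance] AliceStrategy.fintypeA AliceStrategy.decEqA BobStrategy.fintypeB
  BobStrategy.decEqB

section Run

variable {M : Type} [Fintype M] [DecidableEq M]

/-- The joint pure state of Alice's register, the message register and Bob's register after `j`
rounds. -/
def runState (S : AliceStrategy M) (T : BobStrategy M) : ℕ → (S.A × (M × T.B) → ℂ)
  | 0 => fun q => S.init (q.1, q.2.1) * T.init q.2.2
  | j + 1 =>
    Matrix.reindex (Equiv.prodAssoc S.A M T.B) (Equiv.prodAssoc S.A M T.B)
        ((S.act j : Matrix (S.A × M) (S.A × M) ℂ) ⊗ₖ (1 : Matrix T.B T.B ℂ)) *ᵥ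
      (((1 : Matrix S.A S.A ℂ) ⊗ₖ (T.act j : Matrix (M × T.B) (M × T.B) ℂ)) *ᵥ runState S T j)

/-- The probability, after `k` rounds, of the joint event given by the measurement operator `E` on
Alice's side and `F` on Bob's side. -/
def outcomeProb (S : AliceStrategy M) (T : BobStrategy M) (k : ℕ) (E : Matrix S.A S.A ℂ)
    (F : Matrix (M × T.B) (M × T.B) ℂ) : ℝ :=
  (star (runState S T k) ⬝ᵥ ((E ⊗ₖ F) *ᵥ runState S T k)).re

end Run

/-! ### Oblivious transfer -/

/-- A protocol without inputs in which Alice outputs a pair of strings or aborts (`none`), and Bob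
outputs an index and a string or aborts (`none`). -/
structure OTProtocol (n : ℕ) where
  M : Type
  [fintypeM : Fintype M]
  [decEqM : DecidableEq M]
  rounds : ℕ
  alice : AliceStrategy M
  bob : BobStrategy M
  aliceOut : POVM alice.A (Option (StrPair n))
  bobOut : POVM (M × bob.B) (Option (Bit × Str n))

attribute [instance] OTProtocol.fintypeM OTProtocol.decEqM

/-- Two readings of "a cheater learns nothing about the secret without the honest party aborting",
in terms of the probability that the cheater guesses correctly and the honest party does not abort:
relative to the event that the honest party does not abort, or in absolute terms. -/
inductive SecurityNotion
  | conditional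
  | absolute

/-- `guess`: probability of a correct guess without abort; `accept`: probability of no abort;
`q`: probability of a blind guess being correct. -/
def SecurityNotion.Bound (s : SecurityNotion) (q guess accept : ℝ) : Prop :=
  match s with
  | .conditional => guess ≤ q * accept
  | .absolute => guess ≤ q

namespace OTProtocol

variable {n : ℕ}

/-- The joint distribution of the outputs of honest Alice and honest Bob. -/
def honestProb (P : OTProtocol n) (u : Option (StrPair n)) (v : Option (Bit × Str n)) : ℝ :=
  outcomeProb P.alice P.bob P.rounds (P.aliceOut.op u) (P.bobOut.op v)

/-- Correctness of an oblivious string transfer protocol with correctness probability `p`. -/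
structure IsOT (P : OTProtocol n) (p : ℝ) : Prop where
  /-- Alice's strings are independent and uniformly random. -/
  alice_uniform : ∀ z : StrPair n,
    ∑ v : Option (Bit × Str n), P.honestProb (some z) v = (1 / 2 : ℝ) ^ n * (1 / 2 : ℝ) ^ n
  /-- Bob's index is uniformly random. -/
  bob_uniform : ∀ b : Bit,
    ∑ u : Option (StrPair n), ∑ w : Str n, P.honestProb u (some (b, w)) = 1 / 2
  /-- Honest parties do not abort. -/
  alice_no_abort : ∑ v : Option (Bit × Str n), P.honestProb none v = 0
  bob_no_abort : ∑ u : Option (StrPair n), P.honestProb u none = 0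
  /-- Bob's string is the one of Alice's strings with his index, with probability `p`. -/
  correct : ∑ z : StrPair n, ∑ b : Bit, P.honestProb (some z) (some (b, z b)) = p

/-- A cheating Alice, whatever she does and however she guesses, learns nothing about Bob's index
without Bob aborting. -/
def SecureAgainstAlice (P : OTProtocol n) (s : SecurityNotion) : Prop :=
  ∀ (S : AliceStrategy P.M) (G : POVM S.A Bit),
    s.Bound (1 / 2)
      (∑ b : Bit, ∑ w : Str n,
        outcomeProb S P.bob P.rounds (G.op b) (P.bobOut.op (some (b, w))))
      (∑ b : Bit, ∑ w : Str n,
        outcomeProb S P.bob P.rounds 1 (P.bobOut.op (some (b, w))))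

/-- A cheating Bob, whatever he does and however he guesses, learns nothing about the XOR of Alice's
strings without Alice aborting. -/
def SecureAgainstBob (P : OTProtocol n) (s : SecurityNotion) : Prop :=
  ∀ (T : BobStrategy P.M) (G : POVM (P.M × T.B) (Str n)),
    s.Bound ((1 / 2 : ℝ) ^ n)
      (∑ z : StrPair n,
        outcomeProb P.alice T P.rounds (P.aliceOut.op (some z)) (G.op (z 0 + z 1)))
      (∑ z : StrPair n,
        outcomeProb P.alice T P.rounds (P.aliceOut.op (some z)) 1)

/-- Security against both parties. -/
def Secure (P : OTProtocol n) (s : SecurityNotion) : Prop :=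
  P.SecureAgainstAlice s ∧ P.SecureAgainstBob s

/-- The only communication is a single message from Alice to Bob. -/
def NonInteractive (P : OTProtocol n) : Prop :=
  P.rounds = 0

end OTProtocol

end QuantumXOR

end

noncomputable section

namespace QuantumXOR

/-! ### Linear algebra -/

section LinearAlgebra

variable {H Q A : Type} [Fintype H] [DecidableEq H] [Fintype Q] [DecidableEq Q] [Fintype A]

/-! The game is the hub: encodings and protocols both turn into strategies for it, and strategies
turn into both.

Write a bipartite pure state as its coefficient matrix `K`. The probability of the operators `E` for
Alice and `F` for Bob is the trace of `Kᴴ F K Eᵀ`, so `E` matters only through `K Eᵀ Kᴴ` (what Bob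
then holds) and `F` only through `Kᴴ F K`. If no measurement identifies a uniform secret better than
a blind guess, the conditional states for all its values coincide (`eq_of_forall_guess_le`). Hence,
for a fixed XOR `x`, the operators of Alice's pairs `a, a ⊕ x`, multiplied by `2 ^ n`, add up to the
identity as far as the state can tell; so do Bob's operators for a fixed index, multiplied by `2`.
Compressing them to the support of the state makes them genuine measurements
(`exists_povm_of_sum_eq`): `x` becomes Alice's question, the index becomes Bob's, and the success
probability is unchanged (`exists_strategy`). An encoding is first purified, with the pair of
strings kept in Alice's register.

Conversely, Alice plays a random question `x` by herself, gets `a`, and sends Bob's half of the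
state. The game is won exactly when Bob's answer to `c` is the string `c` of the pair `a, a ⊕ x`,
and no-signalling hides `x`. For a protocol, a shared random shift makes `a` uniform.

For optimal decoding, the optima are attained by compactness, and mixing with flagged noise lowers
their average continuously to any value not below that of a blind guess (`learnProb_noisy`). -/

omit [DecidableEq H] in
theorem posSemidef_of_re_nonneg {M : Matrix H H ℂ} (hM : M.IsHermitian)
    (h : ∀ v : H → ℂ, 0 ≤ (star v ⬝ᵥ (M *ᵥ v)).re) : M.PosSemidef := by
  refine .of_dotProduct_mulVec_nonneg hM fun v => ?_
  rw [Complex.le_def]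
  refine ⟨h v, ?_⟩
  have := hM.im_star_dotProduct_mulVec_self v
  simpa using this.symm

omit [DecidableEq H] in
theorem posSemidef_of_isHermitian_of_mul_self {P : Matrix H H ℂ} (h : P.IsHermitian)
    (h2 : P * P = P) : P.PosSemidef := by
  have := Matrix.posSemidef_conjTranspose_mul_self P
  rwa [h.eq, h2] at this

open scoped MatrixOrder in
theorem exists_eq_conjTranspose_mul_self {M : Matrix H H ℂ} (hM : M.PosSemidef) :
    ∃ B : Matrix H H ℂ, M = Bᴴ * B := by
  refine ⟨CFC.sqrt M, ?_⟩
  rw [(Matrix.nonneg_iff_posSemidef.1 (CFC.sqrt_nonneg M)).1.eq, CFC.sqrt_mul_sqrt_self M hM.nonneg]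

theorem one_sub_posSemidef {P : Matrix H H ℂ} (h : P.IsHermitian)
    (h2 : P * P = P) : (1 - P).PosSemidef := by
  refine posSemidef_of_isHermitian_of_mul_self (Matrix.isHermitian_one.sub h) ?_
  simp [mul_sub, sub_mul, h2]

/-- The orthogonal projection onto the range of a matrix. -/
theorem exists_range_projection (K : Matrix Q A ℂ) :
    ∃ (P : Matrix Q Q ℂ) (L : Matrix A Q ℂ), P.IsHermitian ∧ P * K = K ∧ P = K * L := by
  set S := K * Kᴴ with hS
  have hSa : IsSelfAdjoint S := Matrix.isHermitian_mul_conjTranspose_self K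
  have hfin : (spectrum ℝ S).Finite := Matrix.finite_real_spectrum
  have hc : ∀ f : ℝ → ℝ, ContinuousOn f (spectrum ℝ S) := fun f => hfin.continuousOn f
  -- Since `0⁻¹ = 0`, this is the pseudo-inverse of `S`, and `S * T` projects onto the range of `S`,
  -- which is that of `K`.
  set T := cfc (fun x : ℝ => x⁻¹) S with hT
  have hTa : IsSelfAdjoint T := cfc_predicate _ S
  have hid : cfc (fun x : ℝ => x) S = S := cfc_id' ℝ S
  have h1 : S * T = cfc (fun x : ℝ => x * x⁻¹) S := by
    rw [cfc_mul (fun x : ℝ => x) (fun x => x⁻¹) S (hc _) (hc _), hid]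
  have h2 : S * T * S = S := by
    calc S * T * S = cfc (fun x : ℝ => x * x⁻¹) S * cfc (fun x : ℝ => x) S := by rw [h1, hid]
      _ = cfc (fun x : ℝ => x * x⁻¹ * x) S := (cfc_mul _ _ S (hc _) (hc _)).symm
      _ = cfc (fun x : ℝ => x) S :=
        cfc_congr fun x _ => by by_cases hx : x = 0 <;> simp [hx]
      _ = S := hid
  refine ⟨S * T, Kᴴ * T, ?_, ?_, by rw [hS, Matrix.mul_assoc]⟩
  · rw [h1]
    exact cfc_predicate (p := IsSelfAdjoint) _ S
  · have h3 : (S * T - 1) * (K * Kᴴ) = 0 := by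
      rw [← hS, sub_mul, h2, one_mul, sub_self]
    rw [Matrix.mul_self_mul_conjTranspose_eq_zero] at h3
    rwa [Matrix.sub_mul, Matrix.one_mul, sub_eq_zero] at h3

/-- Positive operators which add up to the identity as far as a bipartite state can tell can be
replaced by a measurement. -/
theorem exists_povm_of_sum_eq {ι : Type} [Fintype ι] [DecidableEq ι] [Nonempty ι]
    (K : Matrix Q A ℂ) (X : ι → Matrix Q Q ℂ) (hX : ∀ i, (X i).PosSemidef)
    (hsum : Kᴴ * (∑ i, X i) * K = Kᴴ * K) :
    ∃ Y : POVM Q ι, ∀ i, Kᴴ * Y.op i * K = Kᴴ * X i * K := by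
  obtain ⟨P, L, hP, hPK, hPL⟩ := exists_range_projection K
  have hPP : P * P = P := by
    nth_rw 2 [hPL]
    rw [← Matrix.mul_assoc, hPK, ← hPL]
  have hKP : Kᴴ * P = Kᴴ := by
    have := congrArg Matrix.conjTranspose hPK
    rwa [Matrix.conjTranspose_mul, hP.eq] at this
  have hPL' : P = Lᴴ * Kᴴ := by rw [← Matrix.conjTranspose_mul, ← hPL, hP.eq]
  -- With `P = Lᴴ * Kᴴ = K * L`, the compressed sum only involves `Kᴴ * (∑ i, X i) * K`, which is
  -- known.
  have hcompress : P * (∑ i, X i) * P = P := by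
    nth_rw 1 [hPL']
    nth_rw 1 [hPL]
    calc Lᴴ * Kᴴ * (∑ i, X i) * (K * L) = Lᴴ * (Kᴴ * (∑ i, X i) * K) * L := by
          simp only [Matrix.mul_assoc]
      _ = (Lᴴ * Kᴴ) * (K * L) := by rw [hsum]; simp only [Matrix.mul_assoc]
      _ = P := by rw [← hPL', ← hPL, hPP]
  let i₀ : ι := Classical.arbitrary ι
  -- The compressed operators add up to `P`; the missing `1 - P` is invisible to `K` and can go to
  -- any outcome.
  refine ⟨⟨fun i => P * X i * P + if i = i₀ then 1 - P else 0, fun i => ?_, ?_⟩, fun i => ?_⟩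
  · refine Matrix.PosSemidef.add ?_ ?_
    · have := (hX i).conjTranspose_mul_mul_same P
      rwa [hP.eq] at this
    · split_ifs
      · exact one_sub_posSemidef hP hPP
      · exact .zero
  · rw [Finset.sum_add_distrib, ← Finset.sum_mul, ← Finset.mul_sum, hcompress]
    simp
  · have h0 : Kᴴ * (if i = i₀ then 1 - P else 0) = 0 := by
      split_ifs
      · rw [Matrix.mul_sub, hKP, Matrix.mul_one, sub_self]
      · simp
    dsimp only
    rw [Matrix.mul_add, h0, add_zero, ← Matrix.mul_assoc, ← Matrix.mul_assoc, hKP,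
      Matrix.mul_assoc, hPK]

end LinearAlgebra

/-! ### Measurements -/

namespace POVM

variable {H X : Type} [Fintype H] [DecidableEq H] [Fintype X]

/-- The measurement which always has the outcome `s`. -/
def const (H : Type) [Fintype H] [DecidableEq H] [DecidableEq X] (s : X) : POVM H X where
  op x := if x = s then 1 else 0
  posSemidef x := by split_ifs; exacts [.one, .zero]
  sum_eq_one := by simp

instance [DecidableEq X] [Nonempty X] : Nonempty (POVM H X) :=
  ⟨const H (Classical.arbitrary X)⟩

/-- The measurement `{P, 1 - P}` with the outcomes `s` and `t`. -/
def binary [DecidableEq X] (s t : X) (_hst : s ≠ t) (P : Matrix H H ℂ) (hP : P.PosSemidef)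
    (hP' : (1 - P).PosSemidef) : POVM H X where
  op x := (if x = s then P else 0) + if x = t then 1 - P else 0
  posSemidef x := by
    refine .add ?_ ?_
    · split_ifs; exacts [hP, .zero]
    · split_ifs; exacts [hP', .zero]
  sum_eq_one := by simp [Finset.sum_add_distrib]

end POVM

theorem re_trace_nonneg {H : Type} [Fintype H] {M : Matrix H H ℂ}
    (hM : M.PosSemidef) : 0 ≤ M.trace.re :=
  (Complex.le_def.1 hM.trace_nonneg).1

theorem trace_eq_re {H : Type} [Fintype H] {M : Matrix H H ℂ}
    (hM : M.PosSemidef) : M.trace = (M.trace.re : ℂ) := by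
  apply Complex.ext
  · simp
  · simpa using (Complex.le_def.1 hM.trace_nonneg).2.symm

/-! ### Discriminating the members of an ensemble -/

section Hiding

variable {H X : Type} [Fintype H] [DecidableEq H] [Fintype X] [DecidableEq X]

/-- If no measurement tells the members of an ensemble better than a blind guess, then they are all
equal. -/
theorem eq_of_forall_guess_le (σ : X → Matrix H H ℂ) (hσ : ∀ x, (σ x).PosSemidef)
    (htr : ∑ x, (σ x).trace.re = 1)
    (hguess : ∀ G : POVM H X, ∑ x, ((G.op x * σ x).trace).re ≤ 1 / (Fintype.card X : ℝ))
    (s t : X) : σ s = σ t := by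
  -- Constant guesses bound every trace by the average of all traces, so the traces are equal.
  have hle : ∀ x, (σ x).trace.re ≤ 1 / (Fintype.card X : ℝ) := by
    intro x
    have := hguess (POVM.const H x)
    rw [Finset.sum_eq_single x (by simp +contextual [POVM.const]) (by simp)] at this
    simpa [POVM.const] using this
  have heq : ∀ x, (σ x).trace.re = 1 / (Fintype.card X : ℝ) := by
    have hcard : (Fintype.card X : ℝ) ≠ 0 := by
      have : Nonempty X := ⟨s⟩
      exact_mod_cast Fintype.card_ne_zero
    have h := (Finset.sum_eq_sum_iff_of_le (s := Finset.univ) fun x _ => hle x).1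
      (by rw [htr]; simp [hcard])
    exact fun x => h x (Finset.mem_univ x)
  by_cases hst : s = t
  · rw [hst]
  -- The traces being equal, positivity forces the difference to vanish. To test it at `v`, guess
  -- `s` on the projection onto `v` and `t` on its complement.
  have hpos : (σ t - σ s).PosSemidef := by
    refine posSemidef_of_re_nonneg ((hσ t).1.sub (hσ s).1) fun v => ?_
    by_cases hv : v = 0
    · simp [hv]
    set r : ℂ := star v ⬝ᵥ v with hr
    have hr0 : 0 < r := Matrix.dotProduct_star_self_pos_iff.2 hv
    have hrre : 0 < r.re ∧ r = (r.re : ℂ) := by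
      obtain ⟨h1, h2⟩ := Complex.lt_def.1 hr0
      exact ⟨h1, Complex.ext (by simp) (by simpa using h2.symm)⟩
    set P : Matrix H H ℂ := ((r.re : ℂ)⁻¹) • Matrix.vecMulVec v (star v) with hP
    have hPh : P.IsHermitian := by
      rw [hP, Matrix.IsHermitian, Matrix.conjTranspose_smul, Matrix.conjTranspose_vecMulVec]
      simp
    have hPP : P * P = P := by
      rw [hP, Matrix.smul_mul, Matrix.mul_smul, Matrix.vecMulVec_mul_vecMulVec, ← hr, smul_smul,
        Matrix.vecMulVec_smul, smul_smul, ← hrre.2]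
      congr 1
      field_simp [hr0.ne']
    have h := hguess (POVM.binary s t hst P (posSemidef_of_isHermitian_of_mul_self hPh hPP)
      (one_sub_posSemidef hPh hPP))
    have hsum : ∑ x, (((POVM.binary s t hst P (posSemidef_of_isHermitian_of_mul_self hPh hPP)
        (one_sub_posSemidef hPh hPP)).op x * σ x).trace).re
        = (P * σ s).trace.re + ((1 - P) * σ t).trace.re := by
      simp only [POVM.binary, Matrix.add_mul, Matrix.trace_add, Complex.add_re,
        Finset.sum_add_distrib]
      congr 1
      · rw [Finset.sum_eq_single s (by simp +contextual) (by simp), if_pos rfl]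
      · rw [Finset.sum_eq_single t (by simp +contextual) (by simp), if_pos rfl]
    rw [hsum, Matrix.sub_mul, Matrix.one_mul, Matrix.trace_sub, Complex.sub_re, heq t] at h
    have htrP : ∀ M : Matrix H H ℂ, (P * M).trace.re = r.re⁻¹ * (star v ⬝ᵥ (M *ᵥ v)).re := by
      intro M
      rw [hP, Matrix.smul_mul, Matrix.trace_smul, Matrix.vecMulVec_mul, Matrix.trace_vecMulVec,
        dotProduct_comm, ← Matrix.dotProduct_mulVec, smul_eq_mul, ← Complex.ofReal_inv,
        Complex.re_ofReal_mul]
    rw [htrP, htrP] at h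
    have h' : r.re⁻¹ * (star v ⬝ᵥ (σ s *ᵥ v)).re ≤ r.re⁻¹ * (star v ⬝ᵥ (σ t *ᵥ v)).re := by
      linarith
    have h'' := le_of_mul_le_mul_left h' (inv_pos.2 hrre.1)
    rw [Matrix.sub_mulVec, dotProduct_sub, Complex.sub_re]
    linarith
  have h0 : (σ t - σ s).trace = 0 := by
    rw [trace_eq_re hpos, Matrix.trace_sub, Complex.sub_re, heq, heq]
    simp
  rw [hpos.trace_eq_zero_iff, sub_eq_zero] at h0
  exact h0.symm

theorem eq_smul_sum_of_forall_guess_le (σ : X → Matrix H H ℂ) (hσ : ∀ x, (σ x).PosSemidef)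
    (htr : ∑ x, (σ x).trace.re = 1)
    (hguess : ∀ G : POVM H X, ∑ x, ((G.op x * σ x).trace).re ≤ 1 / (Fintype.card X : ℝ))
    (s : X) : (Fintype.card X : ℂ) • σ s = ∑ x, σ x := by
  rw [Finset.sum_congr rfl fun x _ => eq_of_forall_guess_le σ hσ htr hguess x s]
  rw [Finset.sum_const, Finset.card_univ, Nat.cast_smul_eq_nsmul]

/-- There is a best measurement for the members of an ensemble. -/
theorem exists_optimal_povm [Nonempty X] (σ : X → Matrix H H ℂ) :
    ∃ D : POVM H X, ∀ D' : POVM H X,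
      ∑ x, ((D'.op x * σ x).trace).re ≤ ∑ x, ((D.op x * σ x).trace).re := by
  -- Measurements are parametrised by factors of their operators. The diagonal of the constraint
  -- bounds all entries by `1`, so this set is compact.
  let S : Set (X → Matrix H H ℂ) := {B | ∑ x, (B x)ᴴ * B x = 1}
  have hclosed : IsClosed S := isClosed_eq (by fun_prop) continuous_const
  have hsub : S ⊆ Set.pi Set.univ fun _ => Set.pi Set.univ fun _ => Set.pi Set.univ fun _ =>
      Metric.closedBall (0 : ℂ) 1 := by
    intro B hB x _ i _ j _
    have h1 : ∑ x, ∑ i, ‖B x i j‖ ^ 2 = 1 := by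
      have := congrFun (congrFun hB j) j
      rw [Matrix.one_apply_eq, Matrix.sum_apply] at this
      simp only [Matrix.mul_apply, Matrix.conjTranspose_apply, Complex.star_def,
        Complex.conj_mul'] at this
      exact_mod_cast this
    have h2 : ‖B x i j‖ ^ 2 ≤ 1 := by
      rw [← h1]
      calc ‖B x i j‖ ^ 2 ≤ ∑ i, ‖B x i j‖ ^ 2 :=
            Finset.single_le_sum (f := fun i => ‖B x i j‖ ^ 2) (fun _ _ => by positivity)
              (Finset.mem_univ i)
        _ ≤ _ := Finset.single_le_sum (f := fun x => ∑ i, ‖B x i j‖ ^ 2)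
              (fun _ _ => by positivity) (Finset.mem_univ x)
    rw [mem_closedBall_zero_iff]
    nlinarith [norm_nonneg (B x i j)]
  have hcompact : IsCompact S :=
    (isCompact_univ_pi fun _ => isCompact_univ_pi fun _ => isCompact_univ_pi fun _ =>
      isCompact_closedBall (0 : ℂ) 1).of_isClosed_subset hclosed hsub
  have hfactor : ∀ D : POVM H X, ∃ B ∈ S, ∀ x, D.op x = (B x)ᴴ * B x := by
    intro D
    have h : ∀ x, ∃ B : Matrix H H ℂ, D.op x = Bᴴ * B := fun x =>
      exists_eq_conjTranspose_mul_self (D.posSemidef x)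
    choose B hB using h
    refine ⟨B, ?_, hB⟩
    change ∑ x, (B x)ᴴ * B x = 1
    rw [← D.sum_eq_one]
    exact Finset.sum_congr rfl fun x _ => (hB x).symm
  have hne : S.Nonempty := by
    obtain ⟨B, hB, -⟩ := hfactor (Classical.arbitrary _)
    exact ⟨B, hB⟩
  obtain ⟨B, hB, hmax⟩ := hcompact.exists_isMaxOn
    (f := fun B => ∑ x, ((((B x)ᴴ * B x) * σ x).trace).re) hne
    (Continuous.continuousOn (by
      refine continuous_finsetSum _ fun x _ => Complex.continuous_re.comp ?_
      exact Continuous.matrix_trace (by fun_prop)))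
  refine ⟨⟨fun x => (B x)ᴴ * B x, fun x => Matrix.posSemidef_conjTranspose_mul_self _, hB⟩,
    fun D' => ?_⟩
  obtain ⟨B', hB', hD'⟩ := hfactor D'
  simp only [hD']
  exact hmax hB'

end Hiding

/-! ### Pairs of strings with a given XOR -/

section Pairs

variable {n : ℕ}

/-- The pair of strings `a`, `a ⊕ x`. -/
def pair (a x : Str n) : StrPair n := fun c i => a i + c * x i

theorem pair_zero (a x : Str n) : pair a x 0 = a := by
  funext i; simp [pair]

theorem pair_zero_add_pair_one (a x : Str n) : pair a x 0 + pair a x 1 = x := by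
  funext i
  simp only [pair, Pi.add_apply, zero_mul, add_zero, one_mul]
  rw [← add_assoc, CharTwo.add_self_eq_zero, zero_add]

theorem add_pair_one (a x : Str n) : a + pair a x 1 = x := by
  have h := pair_zero_add_pair_one a x
  rwa [pair_zero] at h

theorem pair_add (a r x : Str n) (c : Bit) : pair (a + r) x c = pair a x c + r := by
  funext i
  simp only [pair, Pi.add_apply]
  ring

/-- A pair of strings is given by the XOR and the first string. -/
def pairEquiv (n : ℕ) : Str n × Str n ≃ StrPair n where
  toFun q := pair q.2 q.1
  invFun z := (z 0 + z 1, z 0)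
  left_inv q := Prod.ext (pair_zero_add_pair_one q.2 q.1) (pair_zero q.2 q.1)
  right_inv z := by
    funext c i
    have hc : ∀ c : Bit, c = 0 ∨ c = 1 := by decide
    rcases hc c with rfl | rfl
    · simp [pair]
    · simp only [pair, Pi.add_apply, one_mul]
      rw [← add_assoc, CharTwo.add_self_eq_zero, zero_add]

theorem sum_strPair {R : Type*} [AddCommMonoid R] (f : StrPair n → R) :
    ∑ z, f z = ∑ x : Str n, ∑ a : Str n, f (pair a x) := by
  rw [← (pairEquiv n).sum_comp, Fintype.sum_prod_type]
  rfl

theorem card_str (n : ℕ) : Fintype.card (Str n) = 2 ^ n := by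
  simp [ZMod.card]

end Pairs

/-! ### Measurements on bipartite pure states -/

section Born

variable {A Q : Type} [Fintype A] [DecidableEq A] [Fintype Q] [DecidableEq Q]

/-- The matrix of coefficients of a bipartite vector. -/
def coeffMatrix (ψ : A × Q → ℂ) : Matrix Q A ℂ := Matrix.of fun q a => ψ (a, q)

/-- The probability of the joint event given by the operators `E` and `F`. -/
def bornProb (ψ : A × Q → ℂ) (E : Matrix A A ℂ) (F : Matrix Q Q ℂ) : ℝ :=
  (star ψ ⬝ᵥ ((E ⊗ₖ F) *ᵥ ψ)).re

omit [DecidableEq A] [DecidableEq Q]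

omit [Fintype A] [Fintype Q] in
theorem vec_coeffMatrix (ψ : A × Q → ℂ) : (coeffMatrix ψ).vec = ψ := rfl

/-- As a vectorization, `K` is sent by `E ⊗ₖ F` to `F * K * Eᵀ`; this is where the transpose on
Alice's side comes from. -/
theorem bornProb_eq_trace (ψ : A × Q → ℂ) (E : Matrix A A ℂ) (F : Matrix Q Q ℂ) :
    bornProb ψ E F = ((coeffMatrix ψ)ᴴ * F * coeffMatrix ψ * Eᵀ).trace.re := by
  have h := Matrix.kronecker_mulVec_vec F (coeffMatrix ψ) E
  have h2 := Matrix.star_vec_dotProduct_vec (coeffMatrix ψ) (F * coeffMatrix ψ * Eᵀ)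
  rw [← h, vec_coeffMatrix] at h2
  rw [bornProb, h2]
  simp only [Matrix.mul_assoc]

theorem bornProb_eq_trace_bob (ψ : A × Q → ℂ) (E : Matrix A A ℂ) (F : Matrix Q Q ℂ) :
    bornProb ψ E F = (F * (coeffMatrix ψ * Eᵀ * (coeffMatrix ψ)ᴴ)).trace.re := by
  rw [bornProb_eq_trace, Matrix.mul_assoc, Matrix.mul_assoc, Matrix.trace_mul_comm]
  simp only [Matrix.mul_assoc]

theorem bornProb_eq_trace_alice (ψ : A × Q → ℂ) (E : Matrix A A ℂ) (F : Matrix Q Q ℂ) :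
    bornProb ψ E F = (E * ((coeffMatrix ψ)ᴴ * F * coeffMatrix ψ)ᵀ).trace.re := by
  rw [bornProb_eq_trace, ← Matrix.trace_transpose, Matrix.transpose_mul, Matrix.transpose_transpose]

theorem bornProb_sum_left {ι : Type*} (s : Finset ι) (ψ : A × Q → ℂ) (E : ι → Matrix A A ℂ)
    (F : Matrix Q Q ℂ) : bornProb ψ (∑ i ∈ s, E i) F = ∑ i ∈ s, bornProb ψ (E i) F := by
  simp only [bornProb_eq_trace, Matrix.transpose_sum, Matrix.mul_sum, Matrix.trace_sum,
    Complex.re_sum]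

theorem bornProb_sum_right {ι : Type*} (s : Finset ι) (ψ : A × Q → ℂ) (E : Matrix A A ℂ)
    (F : ι → Matrix Q Q ℂ) : bornProb ψ E (∑ i ∈ s, F i) = ∑ i ∈ s, bornProb ψ E (F i) := by
  simp only [bornProb_eq_trace_bob, Matrix.sum_mul, Matrix.trace_sum, Complex.re_sum]

theorem bornProb_smul_left (ψ : A × Q → ℂ) (c : ℝ) (E : Matrix A A ℂ) (F : Matrix Q Q ℂ) :
    bornProb ψ ((c : ℂ) • E) F = c * bornProb ψ E F := by
  simp [bornProb_eq_trace]

theorem bornProb_smul_right (ψ : A × Q → ℂ) (c : ℝ) (E : Matrix A A ℂ) (F : Matrix Q Q ℂ) :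
    bornProb ψ E ((c : ℂ) • F) = c * bornProb ψ E F := by
  simp [bornProb_eq_trace]

theorem bornProb_one [DecidableEq A] [DecidableEq Q] (ψ : A × Q → ℂ) :
    bornProb ψ 1 1 = (star ψ ⬝ᵥ ψ).re := by
  simp [bornProb]

end Born

/-! ### The game in terms of pairs of strings -/

section Game

variable {n : ℕ}

/-- Given Alice's answer `a`, exactly one answer `b = a ⊕ y x` wins, and it is the string with index
`y` of the pair with first string `a` and XOR `x`. -/
theorem CHSHStrategy.winProb_eq (S : CHSHStrategy n) :
    S.winProb = (1 / 2 : ℝ) ^ n * (1 / 2) *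
      ∑ x : Str n, ∑ a : Str n, ∑ y : Bit,
        bornProb S.psi ((S.alice x).op a) ((S.bob y).op (pair a x y)) := by
  simp only [CHSHStrategy.winProb, Finset.mul_sum]
  refine Finset.sum_congr rfl fun x _ => ?_
  rw [Finset.sum_comm]
  refine Finset.sum_congr rfl fun a _ => Finset.sum_congr rfl fun y _ => ?_
  have key : ∀ b : Str n, (∀ i, a i + b i = y * x i) ↔ b = pair a x y := by
    intro b
    rw [funext_iff]
    refine forall_congr' fun i => ?_
    rw [pair, ← CharTwo.sub_eq_add (a i), ← CharTwo.sub_eq_add (a i)]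
    constructor
    · intro h; rw [← h]; ring
    · intro h; rw [h]; ring
  simp only [key, mul_ite, mul_zero]
  simp only [Finset.sum_ite_eq', Finset.mem_univ, if_true]
  rfl

/-- A strategy from operators which complete each other only on the support of the state. -/
theorem exists_strategy {A Q : Type} [Fintype A] [DecidableEq A] [Fintype Q] [DecidableEq Q]
    (ψ : A × Q → ℂ) (hψ : star ψ ⬝ᵥ ψ = 1)
    (E : StrPair n → Matrix A A ℂ) (hE : ∀ z, (E z).PosSemidef)
    (F : Bit → Str n → Matrix Q Q ℂ) (hF : ∀ c w, (F c w).PosSemidef)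
    (hEs : ∀ x, coeffMatrix ψ * (∑ a, E (pair a x))ᵀ * (coeffMatrix ψ)ᴴ
      = coeffMatrix ψ * (coeffMatrix ψ)ᴴ)
    (hFs : ∀ c, (coeffMatrix ψ)ᴴ * (∑ w, F c w) * coeffMatrix ψ
      = (coeffMatrix ψ)ᴴ * coeffMatrix ψ) :
    ∃ S : CHSHStrategy n, S.winProb
      = (1 / 2 : ℝ) ^ n * (1 / 2) * ∑ z : StrPair n, ∑ c : Bit, bornProb ψ (E z) (F c (z c)) := by
  obtain ⟨K, hK⟩ : ∃ K, K = coeffMatrix ψ := ⟨_, rfl⟩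
  rw [← hK] at hEs hFs
  have hKT : (Kᵀ)ᴴ = (Kᴴ)ᵀ := rfl
  -- Transposition exchanges the roles of the parties, so that the completion lemma applied to `Kᵀ`
  -- serves Alice.
  have hT : ∀ X : Matrix A A ℂ, (Kᵀ)ᴴ * X * Kᵀ = (K * Xᵀ * Kᴴ)ᵀ := by
    intro X
    rw [Matrix.transpose_mul, Matrix.transpose_mul, Matrix.transpose_transpose, Matrix.mul_assoc,
      hKT]
  have hA : ∀ x : Str n, ∃ Y : POVM A (Str n), ∀ a,
      (Kᵀ)ᴴ * Y.op a * Kᵀ = (Kᵀ)ᴴ * E (pair a x) * Kᵀ := by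
    intro x
    refine exists_povm_of_sum_eq Kᵀ (fun a => E (pair a x)) (fun a => hE _) ?_
    have h1 := hT 1
    rw [Matrix.mul_one, Matrix.transpose_one, Matrix.mul_one] at h1
    rw [hT, hEs, h1]
  have hB : ∀ c : Bit, ∃ Y : POVM Q (Str n), ∀ w, Kᴴ * Y.op w * K = Kᴴ * F c w * K :=
    fun c => exists_povm_of_sum_eq K (F c) (hF c) (hFs c)
  choose Y hY using hA
  choose Z hZ using hB
  refine ⟨{ A := A, B := Q, psi := ψ, psi_unit := hψ, alice := Y, bob := Z }, ?_⟩
  rw [CHSHStrategy.winProb_eq,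
    sum_strPair fun z => ∑ c : Bit, bornProb ψ (E z) (F c (z c))]
  refine congrArg _ ?_
  refine Finset.sum_congr rfl fun x _ => Finset.sum_congr rfl fun a _ =>
    Finset.sum_congr rfl fun y _ => ?_
  have h1 : bornProb ψ ((Y x).op a) ((Z y).op (pair a x y))
      = bornProb ψ ((Y x).op a) (F y (pair a x y)) := by
    rw [bornProb_eq_trace, bornProb_eq_trace, ← hK, hZ]
  have h2 : K * ((Y x).op a)ᵀ * Kᴴ = K * (E (pair a x))ᵀ * Kᴴ := by
    have := hY x a
    rwa [hT, hT, Matrix.transpose_inj] at this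
  change bornProb ψ ((Y x).op a) ((Z y).op (pair a x y)) = _
  rw [h1, bornProb_eq_trace_bob, bornProb_eq_trace_bob, ← hK, h2]

end Game

/-! ### Encodings -/

namespace Encoding

variable {n : ℕ}

/-- The density operator for a pair of strings, weighted with the probability of the pair. -/
def weighted (E : Encoding n) (z : StrPair n) : Matrix E.H E.H ℂ := (E.prior z : ℂ) • E.state z

theorem weighted_posSemidef (E : Encoding n) (z : StrPair n) : (E.weighted z).PosSemidef :=
  (E.state_posSemidef z).smul (by exact_mod_cast E.prior_nonneg z)

theorem weighted_trace (E : Encoding n) (z : StrPair n) : (E.weighted z).trace = E.prior z := by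
  simp [weighted, E.state_trace]

theorem successProb_eq (E : Encoding n) (f : StrPair n → Str n) (D : POVM E.H (Str n)) :
    E.successProb f D = ∑ z, (D.op (f z) * E.weighted z).trace.re := by
  simp [successProb, weighted]

theorem successProb_eq_sum_outcomes (E : Encoding n) (f : StrPair n → Str n)
    (D : POVM E.H (Str n)) :
    E.successProb f D = ∑ s, (D.op s * ∑ z with f z = s, E.weighted z).trace.re := by
  rw [successProb_eq, ← Finset.sum_fiberwise _ f]
  refine Finset.sum_congr rfl fun s _ => ?_
  rw [Matrix.mul_sum, Matrix.trace_sum, Complex.re_sum]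
  refine Finset.sum_congr rfl fun z hz => ?_
  rw [(Finset.mem_filter.1 hz).2]

theorem exists_successProb_max (E : Encoding n) (f : StrPair n → Str n) :
    ∃ D, ∀ D', E.successProb f D' ≤ E.successProb f D := by
  simp only [successProb_eq_sum_outcomes]
  exact exists_optimal_povm _

/-- The attained maximum also supplies the upper bound without which the real supremum would be a
default value. -/
theorem successProb_le_learnProb (E : Encoding n) (f : StrPair n → Str n)
    (D : POVM E.H (Str n)) : E.successProb f D ≤ E.learnProb f := by
  obtain ⟨D', hD'⟩ := E.exists_successProb_max f
  exact le_ciSup (f := fun D => E.successProb f D) ⟨_, Set.forall_mem_range.2 hD'⟩ D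

theorem exists_successProb_eq_learnProb (E : Encoding n) (f : StrPair n → Str n) :
    ∃ D, E.successProb f D = E.learnProb f := by
  obtain ⟨D, hD⟩ := E.exists_successProb_max f
  exact ⟨D, le_antisymm (E.successProb_le_learnProb f D) (ciSup_le hD)⟩

theorem learnProb_eq_of_forall_le (E : Encoding n) (f : StrPair n → Str n) (q : ℝ)
    (hle : ∀ D, E.successProb f D ≤ q) (hex : ∃ D, q ≤ E.successProb f D) :
    E.learnProb f = q := by
  obtain ⟨D, hD⟩ := hex
  exact le_antisymm (ciSup_le hle) (hD.trans (E.successProb_le_learnProb f D))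

/-- The encoding with a given ensemble of weighted density operators. -/
def ofEnsemble {H : Type} [Fintype H] [DecidableEq H] (τ : StrPair n → Matrix H H ℂ)
    (hτ : ∀ z, (τ z).PosSemidef) (h1 : ∑ z, (τ z).trace.re = 1) : Encoding n where
  H := H
  prior z := (τ z).trace.re
  prior_nonneg z := re_trace_nonneg (hτ z)
  prior_sum := h1
  state z := if (τ z).trace.re = 0 then ∑ z, τ z else ((τ z).trace.re : ℂ)⁻¹ • τ z
  state_posSemidef z := by
    split_ifs
    · exact Matrix.posSemidef_sum _ fun z _ => hτ z
    · rw [← Complex.ofReal_inv]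
      exact (hτ z).smul (by exact_mod_cast inv_nonneg.2 (re_trace_nonneg (hτ z)))
  state_trace z := by
    split_ifs with h
    · rw [Matrix.trace_sum, Finset.sum_congr rfl fun z _ => trace_eq_re (hτ z)]
      exact_mod_cast h1
    · rw [Matrix.trace_smul, smul_eq_mul]
      nth_rw 2 [trace_eq_re (hτ z)]
      exact inv_mul_cancel₀ (by exact_mod_cast h)

theorem weighted_ofEnsemble {H : Type} [Fintype H] [DecidableEq H]
    (τ : StrPair n → Matrix H H ℂ) (hτ : ∀ z, (τ z).PosSemidef)
    (h1 : ∑ z, (τ z).trace.re = 1) (z : StrPair n) : (ofEnsemble τ hτ h1).weighted z = τ z := by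
  change ((τ z).trace.re : ℂ) •
    (if (τ z).trace.re = 0 then ∑ z, τ z else ((τ z).trace.re : ℂ)⁻¹ • τ z) = τ z
  split_ifs with h
  · have h0 : (τ z).trace = 0 := by rw [trace_eq_re (hτ z), h, Complex.ofReal_zero]
    rw [(hτ z).trace_eq_zero_iff.1 h0, Matrix.trace_zero, Complex.zero_re, Complex.ofReal_zero,
      zero_smul]
  · rw [smul_smul, mul_inv_cancel₀ (by exact_mod_cast h), one_smul]

theorem successProb_ofEnsemble {H : Type} [Fintype H] [DecidableEq H]
    (τ : StrPair n → Matrix H H ℂ) (hτ : ∀ z, (τ z).PosSemidef)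
    (h1 : ∑ z, (τ z).trace.re = 1) (f : StrPair n → Str n) (D : POVM H (Str n)) :
    (ofEnsemble τ hτ h1).successProb f D = ∑ z, (D.op (f z) * τ z).trace.re := by
  refine (successProb_eq (ofEnsemble τ hτ h1) f D).trans (Finset.sum_congr rfl fun z _ => ?_)
  rw [weighted_ofEnsemble]
  rfl

end Encoding

variable {n : ℕ}

theorem one_half_pow_eq (n : ℕ) : (1 / 2 : ℝ) ^ n = ((2 : ℝ) ^ n)⁻¹ := by
  rw [one_div, inv_pow]

theorem card_str_real (n : ℕ) : (Fintype.card (Str n) : ℝ) = 2 ^ n := by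
  rw [card_str]; push_cast; rfl

theorem card_bit_real : (Fintype.card Bit : ℝ) = 2 := by
  rw [ZMod.card]; norm_num

/-- The members of an ensemble which is part of a state of trace one, up to a part of trace zero,
are equal fractions of that state if no measurement tells them better than a blind guess. -/
theorem smul_eq_of_forall_guess_le {H X : Type} [Fintype H] [DecidableEq H] [Fintype X]
    [DecidableEq X] (N : ℝ) (hN : (Fintype.card X : ℝ) = N) (σ : X → Matrix H H ℂ)
    (σ₀ ρ : Matrix H H ℂ) (hσ : ∀ x, (σ x).PosSemidef) (hσ₀ : σ₀.PosSemidef)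
    (h0 : σ₀.trace.re = 0) (hsum : σ₀ + ∑ x, σ x = ρ) (hρ : ρ.trace.re = 1)
    (hguess : ∀ G : POVM H X, ∑ x, ((G.op x * σ x).trace).re ≤ N⁻¹) (x : X) :
    (N : ℂ) • σ x = ρ := by
  have h0' : σ₀ = 0 := by
    rw [← hσ₀.trace_eq_zero_iff, trace_eq_re hσ₀, h0, Complex.ofReal_zero]
  rw [h0', zero_add] at hsum
  rw [← hsum, ← hN, Complex.ofReal_natCast]
  refine eq_smul_sum_of_forall_guess_le σ hσ ?_ (fun G => ?_) x
  · rw [← hρ, ← hsum, Matrix.trace_sum, Complex.re_sum]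
  · rw [hN, one_div]
    exact hguess G

/-! ### From strategies to encodings and back -/

section EncodingStrategy

theorem Encoding.successProb_xor (E : Encoding n) (D : POVM E.H (Str n)) :
    E.successProb (fun z => z 0 + z 1) D
      = ∑ x, (D.op x * ∑ a, E.weighted (pair a x)).trace.re := by
  rw [E.successProb_eq, sum_strPair]
  simp only [pair_zero_add_pair_one, Matrix.mul_sum, Matrix.trace_sum, Complex.re_sum]

/-- The encoding of `a, a ⊕ x` is what Bob holds after Alice answers `a` to a random question `x`.
Averaged over `a`, it is Bob's reduced state whatever `x` is. Bob's measurement for question `c`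
decodes the string `c`. -/
theorem exists_encoding_of_strategy (S : CHSHStrategy n) :
    ∃ E : Encoding n, E.HidesXOR ∧ E.DecodesWithAverage S.winProb := by
  obtain ⟨K, hK⟩ : ∃ K, K = coeffMatrix S.psi := ⟨_, rfl⟩
  have hK1 : (K * Kᴴ).trace.re = 1 := by
    have h := bornProb_eq_trace_bob S.psi 1 1
    rw [bornProb_one, S.psi_unit, ← hK] at h
    simpa using h.symm
  let q : ℝ := (1 / 2 : ℝ) ^ n
  have hq : 0 ≤ q := by positivity
  let τ : StrPair n → Matrix S.B S.B ℂ := fun z =>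
    (q : ℂ) • (K * ((S.alice (z 0 + z 1)).op (z 0))ᵀ * Kᴴ)
  have hτ : ∀ z, (τ z).PosSemidef := fun z =>
    ((((S.alice _).posSemidef _).transpose).mul_mul_conjTranspose_same K).smul
      (by exact_mod_cast hq)
  have hxor : ∀ x : Str n, ∑ a, τ (pair a x) = (q : ℂ) • (K * Kᴴ) := by
    intro x
    simp only [τ, pair_zero, add_pair_one]
    rw [← Finset.smul_sum, ← Matrix.sum_mul, ← Matrix.mul_sum, ← Matrix.transpose_sum,
      (S.alice x).sum_eq_one, Matrix.transpose_one, Matrix.mul_one]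
  have hcard : (2 ^ n : ℝ) * q = 1 := by
    simp [q]
  have htr : ((q : ℂ) • (K * Kᴴ)).trace.re = q := by
    rw [Matrix.trace_smul, smul_eq_mul, Complex.re_ofReal_mul, hK1, mul_one]
  have h1 : ∑ z, (τ z).trace.re = 1 := by
    rw [← Complex.re_sum, ← Matrix.trace_sum, sum_strPair]
    simp only [hxor]
    rw [Matrix.trace_sum, Complex.re_sum]
    simp only [htr, Finset.sum_const, Finset.card_univ, nsmul_eq_mul]
    rw [card_str_real, hcard]
  refine ⟨Encoding.ofEnsemble τ hτ h1, ?_, S.bob, ?_⟩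
  · have hs : ∀ D : POVM S.B (Str n),
        (Encoding.ofEnsemble τ hτ h1).successProb (fun z => z 0 + z 1) D = q := by
      intro D
      rw [Encoding.successProb_ofEnsemble, sum_strPair]
      simp only [pair_zero, add_pair_one]
      simp only [← Complex.re_sum, ← Matrix.trace_sum, ← Matrix.mul_sum, hxor]
      rw [← Matrix.sum_mul, D.sum_eq_one, Matrix.one_mul, htr]
    exact Encoding.learnProb_eq_of_forall_le _ _ _ (fun D => (hs D).le)
      ⟨POVM.const S.B 0, (hs _).ge⟩
  · have hc : ∀ c, (Encoding.ofEnsemble τ hτ h1).successProb (fun z => z c) (S.bob c)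
        = q * ∑ z : StrPair n,
          bornProb S.psi ((S.alice (z 0 + z 1)).op (z 0)) ((S.bob c).op (z c)) := by
      intro c
      rw [Encoding.successProb_ofEnsemble, Finset.mul_sum]
      refine Finset.sum_congr rfl fun z _ => ?_
      rw [bornProb_eq_trace_bob, ← hK]
      simp only [τ]
      rw [Matrix.mul_smul, Matrix.trace_smul, smul_eq_mul, Complex.re_ofReal_mul]
    simp only [hc]
    rw [← Finset.mul_sum, Finset.sum_comm, CHSHStrategy.winProb_eq, sum_strPair]
    simp only [pair_zero, add_pair_one, q]
    ring

/-- Alice holds the pair of strings and the purification. When she reads `z`, Bob is left with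
`E.weighted z`; hiding makes the total over each XOR class the fraction `2⁻ⁿ` of Bob's state, so her
rescaled readings complete each other. -/
theorem exists_strategy_of_encoding (E : Encoding n) (hE : E.HidesXOR) {p : ℝ}
    (hp : E.DecodesWithAverage p) : ∃ S : CHSHStrategy n, S.winProb = p := by
  obtain ⟨D, hD⟩ := hp
  choose B hB using fun z => exists_eq_conjTranspose_mul_self (E.weighted_posSemidef z)
  -- The conjugation makes the blocks of `K` equal to `(B z)ᴴ`, whence `K * (I z)ᵀ * Kᴴ = (B z)ᴴ * B
  -- z`.
  let ψ : (StrPair n × E.H) × E.H → ℂ := fun q => star (B q.1.1 q.1.2 q.2)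
  obtain ⟨K, hK⟩ : ∃ K, K = coeffMatrix ψ := ⟨_, rfl⟩
  let I : StrPair n → Matrix (StrPair n × E.H) (StrPair n × E.H) ℂ := fun z =>
    Matrix.diagonal fun q => if q.1 = z then 1 else 0
  have hI : ∑ z, I z = 1 := by
    simp only [I]
    ext q q'
    rw [Matrix.sum_apply]
    by_cases h : q = q'
    · subst h; simp
    · simp [h]
  have hIz : ∀ z, K * (I z)ᵀ * Kᴴ = E.weighted z := by
    intro z
    rw [hB z, hK]
    ext i j
    rw [Matrix.diagonal_transpose, Matrix.mul_apply, Matrix.mul_apply]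
    simp only [Matrix.mul_diagonal, Matrix.conjTranspose_apply, coeffMatrix, Matrix.of_apply, ψ,
      Fintype.sum_prod_type]
    rw [Finset.sum_eq_single z (by simp +contextual) (by simp)]
    simp
  have hKK : K * Kᴴ = ∑ z, E.weighted z := by
    simp only [← hIz]
    rw [← Matrix.sum_mul, ← Matrix.mul_sum, ← Matrix.transpose_sum, hI, Matrix.transpose_one,
      Matrix.mul_one]
  have htr : (∑ z, E.weighted z).trace = 1 := by
    rw [Matrix.trace_sum]
    simp only [E.weighted_trace]
    exact_mod_cast E.prior_sum
  have hψ : star ψ ⬝ᵥ ψ = 1 := by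
    have h := Matrix.star_vec_dotProduct_vec K K
    rw [hK, vec_coeffMatrix, ← hK, Matrix.trace_mul_comm, hKK, htr] at h
    exact h
  have hhide : ∀ x : Str n, (((2 : ℝ) ^ n : ℝ) : ℂ) • ∑ a, E.weighted (pair a x)
      = ∑ z, E.weighted z := by
    refine smul_eq_of_forall_guess_le (2 ^ n) (card_str_real n)
      (fun x => ∑ a, E.weighted (pair a x)) 0 _
      (fun x => Matrix.posSemidef_sum _ fun a _ => E.weighted_posSemidef _) .zero (by simp)
      (by rw [zero_add, sum_strPair]) (by rw [htr]; simp) fun G => ?_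
    rw [← E.successProb_xor, ← one_half_pow_eq, ← hE]
    exact E.successProb_le_learnProb _ _
  obtain ⟨S, hS⟩ := exists_strategy ψ hψ (fun z => (((2 : ℝ) ^ n : ℝ) : ℂ) • I z)
    (fun z => (Matrix.PosSemidef.diagonal fun q => by
      dsimp only; split_ifs <;> simp).smul (by exact_mod_cast (by positivity : (0 : ℝ) ≤ 2 ^ n)))
    (fun c w => (D c).op w) (fun c w => (D c).posSemidef w)
    (fun x => by
      rw [← hK, hKK, ← hhide x]
      simp only [← hIz, Matrix.transpose_sum, Matrix.transpose_smul, Matrix.mul_sum,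
        Matrix.sum_mul, Matrix.mul_smul, Matrix.smul_mul, Finset.smul_sum])
    (fun c => by rw [(D c).sum_eq_one, Matrix.mul_one])
  refine ⟨S, ?_⟩
  rw [hS, ← hD]
  simp only [bornProb_smul_left]
  simp only [bornProb_eq_trace_bob, ← hK, hIz, E.successProb_eq]
  rw [Finset.sum_comm, Finset.mul_sum, Finset.mul_sum]
  refine Finset.sum_congr rfl fun c _ => ?_
  rw [← Finset.mul_sum, one_half_pow_eq]
  field_simp

end EncodingStrategy

/-! ### From protocols to strategies -/

theorem star_dotProduct_self_eq_one {ι : Type} [Fintype ι] (v : ι → ℂ)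
    (h : (star v ⬝ᵥ v).re = 1) : star v ⬝ᵥ v = 1 := by
  have h0 : 0 ≤ star v ⬝ᵥ v := dotProduct_star_self_nonneg v
  apply Complex.ext
  · simpa using h
  · simpa using (Complex.le_def.1 h0).2.symm

/-- Security is needed only against parties who are honest up to the final measurement, and
therefore only for the final state of the honest run, however many rounds led to it. -/
theorem exists_strategy_of_protocol (P : OTProtocol n) {p : ℝ} (hP : P.IsOT p)
    {s : SecurityNotion} (hs : P.Secure s) : ∃ S : CHSHStrategy n, S.winProb = p := by
  obtain ⟨ψ, hψ⟩ : ∃ ψ, ψ = runState P.alice P.bob P.rounds := ⟨_, rfl⟩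
  have hout : ∀ E F, outcomeProb P.alice P.bob P.rounds E F = bornProb ψ E F := by
    intro E F; rw [hψ]; rfl
  have hhon : ∀ u v, P.honestProb u v = bornProb ψ (P.aliceOut.op u) (P.bobOut.op v) :=
    fun u v => hout _ _
  have ha : ∀ z, bornProb ψ (P.aliceOut.op (some z)) 1 = (1 / 2 : ℝ) ^ n * (1 / 2 : ℝ) ^ n := by
    intro z
    rw [← hP.alice_uniform z, ← P.bobOut.sum_eq_one, bornProb_sum_right]
    simp only [hhon]
  have ha0 : bornProb ψ (P.aliceOut.op none) 1 = 0 := by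
    rw [← hP.alice_no_abort, ← P.bobOut.sum_eq_one, bornProb_sum_right]
    simp only [hhon]
  have hb : ∀ b, bornProb ψ 1 (∑ w, P.bobOut.op (some (b, w))) = 1 / 2 := by
    intro b
    rw [← hP.bob_uniform b, ← P.aliceOut.sum_eq_one, bornProb_sum_left]
    simp only [bornProb_sum_right, hhon]
  have hb0 : bornProb ψ 1 (P.bobOut.op none) = 0 := by
    rw [← hP.bob_no_abort, ← P.aliceOut.sum_eq_one, bornProb_sum_left]
    simp only [hhon]
  have haccept : ∑ z, bornProb ψ (P.aliceOut.op (some z)) 1 = 1 := by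
    simp only [ha]
    rw [sum_strPair, Finset.sum_const, Finset.sum_const, Finset.card_univ, nsmul_eq_mul,
      nsmul_eq_mul, card_str_real, one_half_pow_eq]
    field_simp
  have hbaccept : ∑ b, bornProb ψ 1 (∑ w, P.bobOut.op (some (b, w))) = 1 := by
    simp only [hb]
    rw [Finset.sum_const, Finset.card_univ, nsmul_eq_mul, card_bit_real]
    norm_num
  have hone : bornProb ψ 1 1 = 1 := by
    rw [← P.aliceOut.sum_eq_one, bornProb_sum_left, Fintype.sum_option, ha0, haccept, zero_add]
  have hunit : star ψ ⬝ᵥ ψ = 1 := star_dotProduct_self_eq_one ψ (by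
    rw [← bornProb_one, hone])
  -- In the honest run nobody aborts, so both senses of security give the same bound.
  have hbobguess : ∀ G : POVM (P.M × P.bob.B) (Str n),
      ∑ z : StrPair n, bornProb ψ (P.aliceOut.op (some z)) (G.op (z 0 + z 1)) ≤ (2 ^ n)⁻¹ := by
    intro G
    have h := hs.2 P.bob G
    simp only [hout, haccept] at h
    rw [← one_half_pow_eq]
    cases s
    · simpa [SecurityNotion.Bound] using h
    · exact h
  have haliceguess : ∀ G : POVM P.alice.A Bit,
      ∑ b, bornProb ψ (G.op b) (∑ w, P.bobOut.op (some (b, w))) ≤ 2⁻¹ := by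
    intro G
    have h := hs.1 P.alice G
    simp only [hout, ← bornProb_sum_right] at h
    rw [bornProb_sum_right, hbaccept] at h
    rw [← one_div]
    cases s
    · simpa [SecurityNotion.Bound] using h
    · exact h
  obtain ⟨K, hK⟩ : ∃ K, K = coeffMatrix ψ := ⟨_, rfl⟩
  have hKK : (K * Kᴴ).trace.re = 1 := by
    rw [← hone, bornProb_eq_trace_bob, ← hK]; simp
  have hKK' : ((Kᴴ * K)ᵀ).trace.re = 1 := by
    rw [Matrix.trace_transpose, Matrix.trace_mul_comm, hKK]
  have hX : ∀ x : Str n, (((2 : ℝ) ^ n : ℝ) : ℂ) •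
      (K * (∑ a, P.aliceOut.op (some (pair a x)))ᵀ * Kᴴ) = K * Kᴴ := by
    refine smul_eq_of_forall_guess_le (2 ^ n) (card_str_real n)
      (fun x => K * (∑ a, P.aliceOut.op (some (pair a x)))ᵀ * Kᴴ)
      (K * (P.aliceOut.op none)ᵀ * Kᴴ) _ (fun x => ?_) ?_ ?_ ?_ hKK fun G => ?_
    · exact (Matrix.posSemidef_sum _ fun a _ =>
        P.aliceOut.posSemidef _).transpose.mul_mul_conjTranspose_same K
    · exact (P.aliceOut.posSemidef _).transpose.mul_mul_conjTranspose_same K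
    · rw [← ha0, bornProb_eq_trace_bob, ← hK, Matrix.one_mul]
    · have h := P.aliceOut.sum_eq_one
      rw [Fintype.sum_option, sum_strPair fun z => P.aliceOut.op (some z)] at h
      rw [← Matrix.sum_mul, ← Matrix.mul_sum, ← Matrix.transpose_sum, ← Matrix.add_mul,
        ← Matrix.mul_add, ← Matrix.transpose_add, h, Matrix.transpose_one, Matrix.mul_one]
    · refine le_trans (le_of_eq ?_) (hbobguess G)
      rw [sum_strPair fun z : StrPair n =>
        bornProb ψ (P.aliceOut.op (some z)) (G.op (z 0 + z 1))]
      refine Finset.sum_congr rfl fun x _ => ?_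
      simp only [pair_zero_add_pair_one]
      rw [← bornProb_sum_left, bornProb_eq_trace_bob, ← hK]
  have hY : ∀ c : Bit, ((2 : ℝ) : ℂ) •
      (Kᴴ * (∑ w, P.bobOut.op (some (c, w))) * K)ᵀ = (Kᴴ * K)ᵀ := by
    refine smul_eq_of_forall_guess_le 2 card_bit_real
      (fun c => (Kᴴ * (∑ w, P.bobOut.op (some (c, w))) * K)ᵀ)
      (Kᴴ * P.bobOut.op none * K)ᵀ _ (fun c => ?_) ?_ ?_ ?_ hKK' fun G => ?_
    · exact ((Matrix.posSemidef_sum _ fun w _ =>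
        P.bobOut.posSemidef _).conjTranspose_mul_mul_same K).transpose
    · exact ((P.bobOut.posSemidef _).conjTranspose_mul_mul_same K).transpose
    · rw [← hb0, bornProb_eq_trace_alice, ← hK, Matrix.one_mul]
    · have h := P.bobOut.sum_eq_one
      rw [Fintype.sum_option, Fintype.sum_prod_type] at h
      rw [← Matrix.transpose_sum, ← Matrix.sum_mul, ← Matrix.mul_sum, ← Matrix.transpose_add,
        ← Matrix.add_mul, ← Matrix.mul_add, h, Matrix.mul_one]
    · refine le_trans (le_of_eq ?_) (haliceguess G)
      refine Finset.sum_congr rfl fun c _ => ?_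
      rw [bornProb_eq_trace_alice, ← hK]
  -- The factors `2 ^ n` and `2` condition on the XOR and on the index, which become the questions.
  obtain ⟨S, hS⟩ := exists_strategy ψ hunit
    (fun z => (((2 : ℝ) ^ n : ℝ) : ℂ) • P.aliceOut.op (some z))
    (fun z => (P.aliceOut.posSemidef _).smul
      (by exact_mod_cast (by positivity : (0 : ℝ) ≤ 2 ^ n)))
    (fun c w => ((2 : ℝ) : ℂ) • P.bobOut.op (some (c, w)))
    (fun c w => (P.bobOut.posSemidef _).smul (by exact_mod_cast (by positivity : (0 : ℝ) ≤ 2)))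
    (fun x => by
      rw [← hK, ← hX x, ← Finset.smul_sum, Matrix.transpose_smul, Matrix.mul_smul,
        Matrix.smul_mul])
    (fun c => by
      rw [← hK, ← Matrix.transpose_inj, ← hY c, ← Finset.smul_sum, Matrix.mul_smul,
        Matrix.smul_mul, Matrix.transpose_smul])
  refine ⟨S, ?_⟩
  rw [hS, ← hP.correct]
  simp only [bornProb_smul_left, bornProb_smul_right, hhon, ← Finset.mul_sum]
  rw [one_half_pow_eq]
  field_simp

/-! ### From strategies to non-interactive protocols -/
theorem runState_zero_unit {M : Type} [Fintype M] [DecidableEq M] (S : AliceStrategy M)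
    (T : BobStrategy M) : star (runState S T 0) ⬝ᵥ runState S T 0 = 1 := by
  have h : star (runState S T 0) ⬝ᵥ runState S T 0
      = (star S.init ⬝ᵥ S.init) * (star T.init ⬝ᵥ T.init) := by
    simp only [dotProduct, runState, Fintype.sum_prod_type, Finset.sum_mul]
    refine Finset.sum_congr rfl fun a _ => Finset.sum_congr rfl fun m _ => ?_
    rw [Finset.mul_sum]
    refine Finset.sum_congr rfl fun b _ => ?_
    simp only [Pi.star_apply, star_mul']
    ring
  rw [h, S.init_unit, T.init_unit, one_mul]

theorem posSemidef_blockDiagonal {H R : Type} [Fintype H] [DecidableEq H] [Fintype R]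
    [DecidableEq R] {M : R → Matrix H H ℂ} (hM : ∀ r, (M r).PosSemidef) :
    (Matrix.blockDiagonal M).PosSemidef := by
  choose B hB using fun r => exists_eq_conjTranspose_mul_self (hM r)
  have h : Matrix.blockDiagonal M = (Matrix.blockDiagonal B)ᴴ * Matrix.blockDiagonal B := by
    rw [Matrix.blockDiagonal_conjTranspose, ← Matrix.blockDiagonal_mul]
    exact congrArg _ (funext hB)
  rw [h]
  exact Matrix.posSemidef_conjTranspose_mul_self _

theorem sum_blockDiagonal {H R ι : Type} [DecidableEq R] [Fintype ι]
    (M : ι → R → Matrix H H ℂ) :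
    ∑ i, Matrix.blockDiagonal (M i) = Matrix.blockDiagonal fun r => ∑ i, M i r := by
  have h := map_sum (Matrix.blockDiagonalAddMonoidHom H H R ℂ) M Finset.univ
  simp only [Matrix.blockDiagonalAddMonoidHom_apply] at h
  rw [← h]
  congr 1
  funext r
  rw [Finset.sum_apply]

theorem blockDiagonal_const_one {H R : Type} [DecidableEq H] [DecidableEq R] :
    Matrix.blockDiagonal (fun _ : R => (1 : Matrix H H ℂ)) = 1 :=
  Matrix.blockDiagonal_one

/-! ### States with shared randomness -/

section SharedRandomness

variable {A B R : Type} [Fintype A] [DecidableEq A] [Fintype B] [DecidableEq B] [Fintype R]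
  [DecidableEq R]

/-- A bipartite vector together with shared randomness, with the amplitude `c` for each value. -/
def withShared (R : Type) [DecidableEq R] (ψ : A × B → ℂ) (c : ℂ) : (A × R) × (B × R) → ℂ :=
  fun q => if q.2.2 = q.1.2 then c * ψ (q.1.1, q.2.1) else 0

omit [Fintype A] [DecidableEq A] [Fintype B] [DecidableEq B] [Fintype R] in
theorem coeffMatrix_withShared (ψ : A × B → ℂ) (c : ℂ) :
    coeffMatrix (withShared R ψ c) = Matrix.blockDiagonal fun _ => c • coeffMatrix ψ := by
  ext ⟨b, r⟩ ⟨a, r'⟩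
  simp [coeffMatrix, withShared, Matrix.blockDiagonal_apply]

omit [DecidableEq A] [DecidableEq B] in
theorem bornProb_withShared (ψ : A × B → ℂ) (c : ℝ) (E : R → Matrix A A ℂ)
    (F : R → Matrix B B ℂ) :
    bornProb (withShared R ψ c) (Matrix.blockDiagonal E) (Matrix.blockDiagonal F)
      = c ^ 2 * ∑ r, bornProb ψ (E r) (F r) := by
  rw [bornProb_eq_trace, coeffMatrix_withShared, Matrix.blockDiagonal_conjTranspose,
    Matrix.blockDiagonal_transpose, ← Matrix.blockDiagonal_mul, ← Matrix.blockDiagonal_mul,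
    ← Matrix.blockDiagonal_mul, Matrix.trace_blockDiagonal, Complex.re_sum, Finset.mul_sum]
  refine Finset.sum_congr rfl fun r _ => ?_
  rw [bornProb_eq_trace, Matrix.conjTranspose_smul, Complex.star_def, Complex.conj_ofReal]
  simp only [Matrix.smul_mul, Matrix.mul_smul, Matrix.trace_smul, smul_eq_mul,
    Complex.re_ofReal_mul]
  ring

-- For the protocol below, where Bob's own register is trivial and he measures only the message.
omit [DecidableEq A] [DecidableEq B] in
theorem bornProb_unit (ψ : A × B → ℂ) (E : Matrix A A ℂ) (F : Matrix B B ℂ) :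
    bornProb (fun q : A × (B × Unit) => ψ (q.1, q.2.1) * 1) E (F.submatrix Prod.fst Prod.fst)
      = bornProb ψ E F := by
  rw [bornProb_eq_trace, bornProb_eq_trace]
  have h : coeffMatrix (fun q : A × (B × Unit) => ψ (q.1, q.2.1) * 1)
      = (coeffMatrix ψ).submatrix (Equiv.prodPUnit B) (Equiv.refl A) := by
    ext ⟨b, u⟩ a
    simp [coeffMatrix]
  have hF : F.submatrix (Prod.fst : B × Unit → B) (Prod.fst : B × Unit → B)
      = F.submatrix (Equiv.prodPUnit B) (Equiv.prodPUnit B) := rfl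
  rw [h, hF, Matrix.conjTranspose_submatrix, Matrix.submatrix_mul_equiv,
    Matrix.submatrix_mul_equiv]
  rfl

end SharedRandomness

namespace CHSHStrategy

/-- The amplitude of each value of the `n` shared random bits. -/
def amplitude (n : ℕ) : ℝ := Real.sqrt ((1 / 2 : ℝ) ^ n)

theorem amplitude_sq (n : ℕ) : amplitude n ^ 2 = (1 / 2 : ℝ) ^ n :=
  Real.sq_sqrt (by positivity)

/-- Alice measures on a random question and shifts the answer by the shared random string. -/
def aliceOp (S : CHSHStrategy n) (z : StrPair n) : Matrix (S.A × Str n) (S.A × Str n) ℂ :=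
  (((1 / 2 : ℝ) ^ n : ℝ) : ℂ) •
    Matrix.blockDiagonal fun r => (S.alice (z 0 + z 1)).op (z 0 + r)

/-- Bob measures on a random question and shifts the answer by the shared random string. -/
def bobOp (S : CHSHStrategy n) (b : Bit) (w : Str n) : Matrix (S.B × Str n) (S.B × Str n) ℂ :=
  ((1 / 2 : ℝ) : ℂ) • Matrix.blockDiagonal fun r => (S.bob b).op (w + r)

theorem aliceOp_posSemidef (S : CHSHStrategy n) (z : StrPair n) : (S.aliceOp z).PosSemidef :=
  (posSemidef_blockDiagonal fun _ => (S.alice _).posSemidef _).smul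
    (by exact_mod_cast (by positivity : (0 : ℝ) ≤ (1 / 2 : ℝ) ^ n))

theorem bobOp_posSemidef (S : CHSHStrategy n) (b : Bit) (w : Str n) :
    (S.bobOp b w).PosSemidef :=
  (posSemidef_blockDiagonal fun _ => (S.bob _).posSemidef _).smul
    (by exact_mod_cast (by positivity : (0 : ℝ) ≤ (1 / 2 : ℝ)))

theorem sum_op_add {H : Type} [Fintype H] [DecidableEq H] (D : POVM H (Str n)) (r : Str n) :
    ∑ a, D.op (a + r) = 1 := by
  rw [← D.sum_eq_one]
  exact Equiv.sum_comp (Equiv.addRight r) D.op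

/-- The XOR is Alice's own random question. A multiple of the identity carries no correlation, so
Bob can learn nothing about it whatever he does; `sum_bobOp` does the same for Bob's index. -/
theorem sum_aliceOp_pair (S : CHSHStrategy n) (x : Str n) :
    ∑ a, S.aliceOp (pair a x) = (((1 / 2 : ℝ) ^ n : ℝ) : ℂ) • 1 := by
  simp only [aliceOp, pair_zero, add_pair_one]
  rw [← Finset.smul_sum, sum_blockDiagonal]
  simp only [sum_op_add, blockDiagonal_const_one]

theorem sum_bobOp (S : CHSHStrategy n) (b : Bit) :
    ∑ w, S.bobOp b w = ((1 / 2 : ℝ) : ℂ) • 1 := by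
  simp only [bobOp]
  rw [← Finset.smul_sum, sum_blockDiagonal]
  simp only [sum_op_add, blockDiagonal_const_one]

theorem one_submatrix_fst {H : Type} [DecidableEq H] :
    (1 : Matrix H H ℂ).submatrix (Prod.fst : H × Unit → H)
      (Prod.fst : H × Unit → H) = 1 := by
  ext i j
  simp [Matrix.one_apply, Prod.ext_iff]

theorem sum_bobOp_submatrix (S : CHSHStrategy n) (b : Bit) :
    ∑ w, (S.bobOp b w).submatrix (Prod.fst : (S.B × Str n) × Unit → S.B × Str n)
        (Prod.fst : (S.B × Str n) × Unit → S.B × Str n)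
      = ((1 / 2 : ℝ) : ℂ) • 1 := by
  rw [← one_submatrix_fst]
  ext i j
  have h := congrFun (congrFun (S.sum_bobOp b) i.1) j.1
  rw [Matrix.sum_apply] at h ⊢
  exact h

theorem bornProb_aliceOp_bobOp (S : CHSHStrategy n) (z : StrPair n) (b : Bit) (w : Str n) :
    bornProb (withShared (Str n) S.psi (amplitude n)) (S.aliceOp z) (S.bobOp b w)
      = (1 / 2 : ℝ) ^ n * (1 / 2 : ℝ) ^ n * (1 / 2) *
        ∑ r, bornProb S.psi ((S.alice (z 0 + z 1)).op (z 0 + r)) ((S.bob b).op (w + r)) := by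
  rw [aliceOp, bobOp, bornProb_smul_left, bornProb_smul_right, bornProb_withShared, amplitude_sq]
  ring

theorem withShared_unit (S : CHSHStrategy n) :
    star (withShared (Str n) S.psi (amplitude n)) ⬝ᵥ withShared (Str n) S.psi (amplitude n)
      = 1 := by
  apply star_dotProduct_self_eq_one
  rw [← bornProb_one, ← blockDiagonal_const_one, ← blockDiagonal_const_one, bornProb_withShared,
    amplitude_sq]
  simp only [bornProb_one, S.psi_unit, Complex.one_re, Finset.sum_const, Finset.card_univ,
    nsmul_eq_mul, mul_one]
  rw [card_str_real]
  simp

/-- This is what the shared string is for: the shift runs over all of Alice's answers and makes her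
output uniform. -/
theorem bornProb_aliceOp_one (S : CHSHStrategy n) (z : StrPair n) :
    bornProb (withShared (Str n) S.psi (amplitude n)) (S.aliceOp z) 1
      = (1 / 2 : ℝ) ^ n * (1 / 2 : ℝ) ^ n := by
  have h : ∑ r, (S.alice (z 0 + z 1)).op (z 0 + r) = 1 := by
    simp only [add_comm (z 0) _]
    exact sum_op_add _ _
  rw [aliceOp, bornProb_smul_left, ← blockDiagonal_const_one, bornProb_withShared, amplitude_sq,
    ← bornProb_sum_left, h, bornProb_one, S.psi_unit, Complex.one_re, mul_one]

/-- Both parties shift by the same `r`, and shifting `a` shifts both strings of the pair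
(`pair_add`); each `r` thus contributes as much as the unshifted game. -/
theorem sum_bornProb_correct (S : CHSHStrategy n) :
    ∑ z : StrPair n, ∑ b : Bit,
      bornProb (withShared (Str n) S.psi (amplitude n)) (S.aliceOp z) (S.bobOp b (z b))
      = S.winProb := by
  simp only [bornProb_aliceOp_bobOp]
  rw [sum_strPair, winProb_eq]
  simp only [pair_zero, add_pair_one, ← pair_add, ← Finset.mul_sum]
  rw [mul_assoc, mul_assoc, mul_assoc]
  congr 1
  rw [mul_left_comm]
  congr 1
  rw [Finset.mul_sum]
  refine Finset.sum_congr rfl fun x _ => ?_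
  have h : ∀ r : Str n,
      ∑ a, ∑ b, bornProb S.psi ((S.alice x).op (a + r)) ((S.bob b).op (pair (a + r) x b))
      = ∑ a, ∑ b, bornProb S.psi ((S.alice x).op a) ((S.bob b).op (pair a x b)) := fun r =>
    Equiv.sum_comp (Equiv.addRight r) fun a =>
      ∑ b, bornProb S.psi ((S.alice x).op a) ((S.bob b).op (pair a x b))
  calc _ = (1 / 2 : ℝ) ^ n * ∑ r : Str n, ∑ a, ∑ b,
        bornProb S.psi ((S.alice x).op (a + r)) ((S.bob b).op (pair (a + r) x b)) := by
        refine congrArg _ ?_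
        exact (Finset.sum_congr rfl fun a _ => Finset.sum_comm).trans Finset.sum_comm
    _ = _ := by
        simp only [h, Finset.sum_const, Finset.card_univ, nsmul_eq_mul]
        rw [card_str_real, one_half_pow_eq]
        field_simp

/-- The non-interactive protocol in which Alice sends Bob's share of the state, together with a
random shift of the answers. -/
def protocol (S : CHSHStrategy n) : OTProtocol n where
  M := S.B × Str n
  rounds := 0
  alice :=
    { A := S.A × Str n
      init := withShared (Str n) S.psi (amplitude n)
      init_unit := S.withShared_unit
      act := fun _ => 1 }
  bob :=
    { B := Unit
      init := fun _ => 1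
      init_unit := by simp
      act := fun _ => 1 }
  aliceOut :=
    { op := fun u => u.elim 0 S.aliceOp
      posSemidef := fun u => by
        cases u
        · exact .zero
        · exact S.aliceOp_posSemidef _
      sum_eq_one := by
        rw [Fintype.sum_option]
        simp only [Option.elim]
        rw [zero_add, sum_strPair]
        simp only [sum_aliceOp_pair, Finset.sum_const, Finset.card_univ]
        rw [← Nat.cast_smul_eq_nsmul ℂ, smul_smul, ← Complex.ofReal_natCast, card_str_real,
          ← Complex.ofReal_mul, one_half_pow_eq, mul_inv_cancel₀ (by positivity),
          Complex.ofReal_one, one_smul] }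
  bobOut :=
    { op := fun v => v.elim 0 fun q => (S.bobOp q.1 q.2).submatrix Prod.fst Prod.fst
      posSemidef := fun v => by
        cases v
        · exact .zero
        · exact (S.bobOp_posSemidef _ _).submatrix _
      sum_eq_one := by
        rw [Fintype.sum_option]
        simp only [Option.elim]
        have h : ∑ q : Bit × Str n, S.bobOp q.1 q.2 = 1 := by
          rw [Fintype.sum_prod_type]
          simp only [sum_bobOp, Finset.sum_const, Finset.card_univ]
          rw [← Nat.cast_smul_eq_nsmul ℂ, smul_smul, ← Complex.ofReal_natCast, card_bit_real,
            ← Complex.ofReal_mul]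
          norm_num
        ext i j
        rw [zero_add, Matrix.sum_apply]
        simp only [Matrix.submatrix_apply]
        rw [← Matrix.sum_apply, h]
        simp [Matrix.one_apply, Prod.ext_iff] }

theorem protocol_nonInteractive (S : CHSHStrategy n) : S.protocol.NonInteractive := rfl

theorem protocol_outcomeProb (S : CHSHStrategy n) (E : Matrix (S.A × Str n) (S.A × Str n) ℂ)
    (F : Matrix (S.B × Str n) (S.B × Str n) ℂ) :
    outcomeProb S.protocol.alice S.protocol.bob 0 E (F.submatrix Prod.fst Prod.fst)
      = bornProb (withShared (Str n) S.psi (amplitude n)) E F :=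
  bornProb_unit _ E F

theorem protocol_sum_bobOut (S : CHSHStrategy n) (b : Bit) :
    ∑ w, S.protocol.bobOut.op (some (b, w)) = ((1 / 2 : ℝ) : ℂ) • 1 :=
  S.sum_bobOp_submatrix b

theorem protocol_sum_aliceOut (S : CHSHStrategy n) (x : Str n) :
    ∑ a, S.protocol.aliceOut.op (some (pair a x)) = (((1 / 2 : ℝ) ^ n : ℝ) : ℂ) • 1 :=
  S.sum_aliceOp_pair x

theorem outcomeProb_one_one (S : CHSHStrategy n) (T : AliceStrategy S.protocol.M)
    (U : BobStrategy S.protocol.M) : outcomeProb T U S.protocol.rounds 1 1 = 1 := by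
  have h : outcomeProb T U S.protocol.rounds 1 1 = bornProb (runState T U 0) 1 1 := rfl
  rw [h, bornProb_one, runState_zero_unit, Complex.one_re]

theorem outcomeProb_eq_bornProb {M : Type} [Fintype M] [DecidableEq M] (S : AliceStrategy M)
    (T : BobStrategy M) (k : ℕ) (E : Matrix S.A S.A ℂ) (F : Matrix (M × T.B) (M × T.B) ℂ) :
    outcomeProb S T k E F = bornProb (runState S T k) E F := rfl

theorem protocol_secure (S : CHSHStrategy n) (s : SecurityNotion) : S.protocol.Secure s := by
  constructor
  · intro T G
    have hguess : ∑ b : Bit, ∑ w : Str n, outcomeProb T S.protocol.bob S.protocol.rounds (G.op b)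
        (S.protocol.bobOut.op (some (b, w))) = 1 / 2 := by
      simp only [outcomeProb_eq_bornProb, ← bornProb_sum_right, protocol_sum_bobOut,
        bornProb_smul_right]
      rw [← Finset.mul_sum, ← bornProb_sum_left, G.sum_eq_one, ← outcomeProb_eq_bornProb,
        outcomeProb_one_one, mul_one]
    have haccept : ∑ b : Bit, ∑ w : Str n, outcomeProb T S.protocol.bob S.protocol.rounds 1
        (S.protocol.bobOut.op (some (b, w))) = 1 := by
      simp only [outcomeProb_eq_bornProb, ← bornProb_sum_right, protocol_sum_bobOut,
        bornProb_smul_right, Finset.sum_const, Finset.card_univ, nsmul_eq_mul]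
      rw [← outcomeProb_eq_bornProb, outcomeProb_one_one, card_bit_real]
      norm_num
    rw [hguess, haccept]
    cases s <;> simp [SecurityNotion.Bound]
  · intro T G
    have hguess : ∑ z : StrPair n, outcomeProb S.protocol.alice T S.protocol.rounds
        (S.protocol.aliceOut.op (some z)) (G.op (z 0 + z 1)) = (1 / 2 : ℝ) ^ n := by
      rw [sum_strPair]
      simp only [pair_zero, add_pair_one, outcomeProb_eq_bornProb, ← bornProb_sum_left,
        protocol_sum_aliceOut, bornProb_smul_left]
      rw [← Finset.mul_sum, ← bornProb_sum_right, G.sum_eq_one, ← outcomeProb_eq_bornProb,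
        outcomeProb_one_one, mul_one]
    have haccept : ∑ z : StrPair n, outcomeProb S.protocol.alice T S.protocol.rounds
        (S.protocol.aliceOut.op (some z)) 1 = 1 := by
      rw [sum_strPair]
      simp only [outcomeProb_eq_bornProb, ← bornProb_sum_left,
        protocol_sum_aliceOut, bornProb_smul_left, Finset.sum_const, Finset.card_univ,
        nsmul_eq_mul]
      rw [← outcomeProb_eq_bornProb, outcomeProb_one_one, card_str_real, mul_one, one_half_pow_eq,
        mul_inv_cancel₀ (by positivity)]
    rw [hguess, haccept]
    cases s <;> simp [SecurityNotion.Bound]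

theorem protocol_isOT (S : CHSHStrategy n) : S.protocol.IsOT S.winProb where
  alice_uniform z := by
    simp only [OTProtocol.honestProb, outcomeProb_eq_bornProb]
    rw [← bornProb_sum_right, S.protocol.bobOut.sum_eq_one, ← S.bornProb_aliceOp_one z]
    refine Eq.trans ?_ (bornProb_unit _ (S.aliceOp z) 1)
    rw [one_submatrix_fst]
    rfl
  bob_uniform b := by
    simp only [OTProtocol.honestProb, outcomeProb_eq_bornProb, ← bornProb_sum_right,
      protocol_sum_bobOut, bornProb_smul_right]
    rw [← Finset.mul_sum, ← bornProb_sum_left, S.protocol.aliceOut.sum_eq_one,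
      ← outcomeProb_eq_bornProb, outcomeProb_one_one, mul_one]
  alice_no_abort := by
    have h : S.protocol.aliceOut.op none = 0 := rfl
    refine Finset.sum_eq_zero fun v _ => ?_
    rw [OTProtocol.honestProb, h, outcomeProb_eq_bornProb, bornProb_eq_trace]
    simp
  bob_no_abort := by
    have h : S.protocol.bobOut.op none = 0 := rfl
    refine Finset.sum_eq_zero fun v _ => ?_
    rw [OTProtocol.honestProb, h, outcomeProb_eq_bornProb, bornProb_eq_trace]
    simp
  correct := by
    rw [← S.sum_bornProb_correct]
    exact Finset.sum_congr rfl fun z _ => Finset.sum_congr rfl fun b _ =>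
      S.protocol_outcomeProb _ _

end CHSHStrategy

/-! ### Mixing an encoding with noise -/

theorem posSemidef_fromBlocks_diagonal {H H' : Type} [Fintype H] [DecidableEq H] [Fintype H']
    [DecidableEq H'] {M : Matrix H H ℂ} {N : Matrix H' H' ℂ} (hM : M.PosSemidef)
    (hN : N.PosSemidef) : (Matrix.fromBlocks M 0 0 N).PosSemidef := by
  obtain ⟨B, hB⟩ := exists_eq_conjTranspose_mul_self hM
  obtain ⟨C, hC⟩ := exists_eq_conjTranspose_mul_self hN
  have h : Matrix.fromBlocks M 0 0 N
      = (Matrix.fromBlocks B 0 0 C)ᴴ * Matrix.fromBlocks B 0 0 C := by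
    rw [Matrix.fromBlocks_conjTranspose, Matrix.fromBlocks_multiply, hB, hC]
    simp
  rw [h]
  exact Matrix.posSemidef_conjTranspose_mul_self _

theorem trace_fromBlocks {H H' : Type} [Fintype H] [Fintype H'] (A : Matrix H H ℂ)
    (B : Matrix H H' ℂ) (C : Matrix H' H ℂ) (D : Matrix H' H' ℂ) :
    (Matrix.fromBlocks A B C D).trace = A.trace + D.trace := by
  simp [Matrix.trace, Fintype.sum_sum_type]

/-! ### Measurements on direct sums -/

namespace POVM

variable {H H' X : Type} [Fintype H] [DecidableEq H] [Fintype H'] [DecidableEq H'] [Fintype X]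

/-- The restriction of a measurement to a subsystem of a direct sum. -/
def restrict (D : POVM H' X) (e : H ↪ H') : POVM H X where
  op x := (D.op x).submatrix e e
  posSemidef x := (D.posSemidef x).submatrix e
  sum_eq_one := by
    ext i j
    rw [Matrix.sum_apply]
    simp only [Matrix.submatrix_apply]
    rw [← Matrix.sum_apply, D.sum_eq_one]
    simp [Matrix.one_apply]

/-- A measurement on each of the two summands of a system. -/
def directSum (D : POVM H X) (D' : POVM H' X) : POVM (H ⊕ H') X where
  op x := Matrix.fromBlocks (D.op x) 0 0 (D'.op x)
  posSemidef x := posSemidef_fromBlocks_diagonal (D.posSemidef x) (D'.posSemidef x)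
  sum_eq_one := by
    rw [← Matrix.fromBlocks_one, ← D.sum_eq_one, ← D'.sum_eq_one]
    ext i j
    rw [Matrix.sum_apply]
    rcases i with i | i <;> rcases j with j | j <;> simp [Matrix.sum_apply]

omit [DecidableEq H] [DecidableEq H'] in
theorem trace_mul_fromBlocks_diagonal (M : Matrix (H ⊕ H') (H ⊕ H') ℂ) (A : Matrix H H ℂ)
    (B : Matrix H' H' ℂ) :
    (M * Matrix.fromBlocks A 0 0 B).trace
      = (M.submatrix Sum.inl Sum.inl * A).trace + (M.submatrix Sum.inr Sum.inr * B).trace := by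
  conv_lhs => rw [← Matrix.fromBlocks_toBlocks M]
  rw [Matrix.fromBlocks_multiply, trace_fromBlocks]
  simp only [Matrix.mul_zero, add_zero, zero_add]
  rfl

end POVM

/-- A function of two strings whose value is uniform if the strings are. -/
def IsBalanced (f : StrPair n → Str n) : Prop :=
  ∀ g : Str n → ℝ, ∑ z, g (f z) = 2 ^ n * ∑ s, g s

theorem isBalanced_apply (c : Bit) : IsBalanced (fun z : StrPair n => z c) := by
  intro g
  rw [sum_strPair]
  have h : ∀ x : Str n, ∑ a, g (pair a x c) = ∑ s, g s := by
    intro x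
    have h' : ∀ a, g (pair a x c) = g (Equiv.addRight (pair 0 x c) a) := by
      intro a
      simp only [Equiv.coe_addRight]
      rw [add_comm a, ← pair_add, zero_add]
    exact (Finset.sum_congr rfl fun a _ => h' a).trans (Equiv.sum_comp _ g)
  simp only [h, Finset.sum_const, Finset.card_univ, nsmul_eq_mul]
  rw [card_str_real]

theorem isBalanced_xor : IsBalanced (fun z : StrPair n => z 0 + z 1) := by
  intro g
  rw [sum_strPair]
  simp only [pair_zero, add_pair_one, Finset.sum_const, Finset.card_univ, nsmul_eq_mul]
  rw [card_str_real, Finset.mul_sum]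

namespace Encoding

/-- The weighted states of the encoding which is `E` with probability `l`, and a uniformly random
pair of strings without any information on it otherwise; a flag tells which is the case. -/
def noisyState (E : Encoding n) (l : ℝ) (z : StrPair n) :
    Matrix (E.H ⊕ Unit) (E.H ⊕ Unit) ℂ :=
  Matrix.fromBlocks ((l : ℂ) • E.weighted z) 0 0
    ((((1 - l) * ((1 / 2 : ℝ) ^ n * (1 / 2 : ℝ) ^ n) : ℝ) : ℂ) • 1)

theorem sum_trace_noisyState (E : Encoding n) (l : ℝ) :
    ∑ z, (E.noisyState l z).trace.re = 1 := by
  have h : ∀ z, (E.noisyState l z).trace.re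
      = l * E.prior z + (1 - l) * ((1 / 2 : ℝ) ^ n * (1 / 2 : ℝ) ^ n) := by
    intro z
    rw [noisyState, trace_fromBlocks, Matrix.trace_smul, Matrix.trace_smul,
      E.weighted_trace, smul_eq_mul, smul_eq_mul, Complex.add_re, Complex.re_ofReal_mul,
      Complex.re_ofReal_mul]
    simp
  simp only [h]
  rw [Finset.sum_add_distrib, ← Finset.mul_sum, E.prior_sum, sum_strPair, Finset.sum_const,
    Finset.sum_const, Finset.card_univ, nsmul_eq_mul, nsmul_eq_mul, card_str_real,
    one_half_pow_eq]
  field_simp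
  ring

theorem noisyState_posSemidef (E : Encoding n) {l : ℝ} (h0 : 0 ≤ l) (h1 : l ≤ 1)
    (z : StrPair n) : (E.noisyState l z).PosSemidef := by
  refine posSemidef_fromBlocks_diagonal
    ((E.weighted_posSemidef z).smul (by exact_mod_cast h0))
    (Matrix.PosSemidef.one.smul ?_)
  have : 0 ≤ (1 - l) * ((1 / 2 : ℝ) ^ n * (1 / 2 : ℝ) ^ n) :=
    mul_nonneg (sub_nonneg.2 h1) (by positivity)
  exact_mod_cast this

/-- The encoding which is `E` with probability `l` and noise otherwise. -/
def noisy (E : Encoding n) {l : ℝ} (h0 : 0 ≤ l) (h1 : l ≤ 1) : Encoding n :=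
  ofEnsemble (E.noisyState l) (E.noisyState_posSemidef h0 h1) (E.sum_trace_noisyState l)

/-- A block diagonal state sees only the diagonal blocks of `D`. On the noise block the value of `f`
is uniform and independent of the outcome. -/
theorem successProb_noisy (E : Encoding n) {l : ℝ} (h0 : 0 ≤ l) (h1 : l ≤ 1)
    {f : StrPair n → Str n} (hf : IsBalanced f) (D : POVM (E.H ⊕ Unit) (Str n)) :
    (E.noisy h0 h1).successProb f D
      = l * E.successProb f (D.restrict Function.Embedding.inl) + (1 - l) * (1 / 2 : ℝ) ^ n := by
  have hnoise : ∑ z, ((D.restrict Function.Embedding.inr).op (f z)).trace.re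
      = (2 : ℝ) ^ n := by
    rw [hf fun s => ((D.restrict Function.Embedding.inr).op s).trace.re, ← Complex.re_sum,
      ← Matrix.trace_sum, POVM.sum_eq_one]
    simp
  refine (successProb_ofEnsemble (E.noisyState l) (E.noisyState_posSemidef h0 h1)
    (E.sum_trace_noisyState l) f D).trans ?_
  rw [successProb_eq]
  have h : ∀ z, (D.op (f z) * E.noisyState l z).trace.re
      = l * ((D.restrict Function.Embedding.inl).op (f z) * E.weighted z).trace.re
        + (1 - l) * ((1 / 2 : ℝ) ^ n * (1 / 2 : ℝ) ^ n)
          * ((D.restrict Function.Embedding.inr).op (f z)).trace.re := by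
    intro z
    rw [noisyState, POVM.trace_mul_fromBlocks_diagonal, Matrix.mul_smul, Matrix.mul_smul,
      Matrix.mul_one, Matrix.trace_smul, Matrix.trace_smul, smul_eq_mul, smul_eq_mul,
      Complex.add_re, Complex.re_ofReal_mul, Complex.re_ofReal_mul]
    rfl
  simp only [h]
  rw [Finset.sum_add_distrib, ← Finset.mul_sum, ← Finset.mul_sum, hnoise, one_half_pow_eq]
  field_simp

/-- The flag lets a decoder use the best measurement for `E` when there is no noise; under noise
every outcome is equally good. -/
theorem learnProb_noisy (E : Encoding n) {l : ℝ} (h0 : 0 ≤ l) (h1 : l ≤ 1)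
    {f : StrPair n → Str n} (hf : IsBalanced f) :
    (E.noisy h0 h1).learnProb f = l * E.learnProb f + (1 - l) * (1 / 2 : ℝ) ^ n := by
  obtain ⟨D, hD⟩ := E.exists_successProb_eq_learnProb f
  refine learnProb_eq_of_forall_le _ _ _ (fun D' => ?_)
    ⟨D.directSum (POVM.const Unit 0), ?_⟩
  · rw [E.successProb_noisy h0 h1 hf D']
    have := E.successProb_le_learnProb f (POVM.restrict (H' := E.H ⊕ Unit) D'
      Function.Embedding.inl)
    gcongr
  · have h : E.successProb f ((D.directSum (POVM.const Unit 0)).restrict Function.Embedding.inl)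
        = E.successProb f D := rfl
    rw [E.successProb_noisy h0 h1 hf, h, hD]

theorem exists_optimalAverage_eq (E : Encoding n) (hE : E.HidesXOR) {p : ℝ}
    (hp : E.DecodesWithAverage p) (hnp : (1 / 2 : ℝ) ^ n ≤ p) :
    ∃ E' : Encoding n, E'.HidesXOR ∧ E'.optimalAverage = p := by
  obtain ⟨D, hD⟩ := hp
  have hle : p ≤ E.optimalAverage := by
    rw [← hD, optimalAverage]
    gcongr
    exact E.successProb_le_learnProb _ _
  rcases eq_or_lt_of_le hle with heq | hlt
  -- Treating this case apart keeps the denominator of the mixing weight nonzero.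
  · exact ⟨E, hE, heq.symm⟩
  set q : ℝ := (1 / 2 : ℝ) ^ n with hq
  have hpos : 0 < E.optimalAverage - q := by linarith
  -- The weight `l` solves `l * E.optimalAverage + (1 - l) * q = p`.
  have h0 : 0 ≤ (p - q) / (E.optimalAverage - q) := div_nonneg (by linarith) hpos.le
  have h1 : (p - q) / (E.optimalAverage - q) ≤ 1 := (div_le_one hpos).2 (by linarith)
  refine ⟨E.noisy h0 h1, ?_, ?_⟩
  · have hE' : E.learnProb (fun x => x 0 + x 1) = q := hE
    rw [HidesXOR, E.learnProb_noisy h0 h1 isBalanced_xor, hE', ← hq]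
    ring
  · have h : (E.noisy h0 h1).optimalAverage
        = (p - q) / (E.optimalAverage - q) * E.optimalAverage
          + (1 - (p - q) / (E.optimalAverage - q)) * q := by
      rw [optimalAverage, Finset.sum_congr rfl fun c _ =>
        E.learnProb_noisy h0 h1 (isBalanced_apply c), Finset.sum_add_distrib, ← Finset.mul_sum,
        Finset.sum_const, Finset.card_univ, nsmul_eq_mul, card_bit_real, ← hq]
      have h' : ∑ c : Bit, E.learnProb (fun x => x c) = 2 * E.optimalAverage := by
        rw [optimalAverage]; ring
      rw [h']
      ring
    rw [h]
    field_simp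
    ring

theorem decodesWithAverage_optimalAverage (E : Encoding n) :
    E.DecodesWithAverage E.optimalAverage := by
  choose D hD using fun c : Bit => E.exists_successProb_eq_learnProb fun x => x c
  refine ⟨D, ?_⟩
  rw [optimalAverage]
  simp only [hD]

end Encoding

end QuantumXOR

end

theorem theorem3 (n : ℕ) (p : ℝ) (s : QuantumXOR.SecurityNotion) :
    [ ∃ E : QuantumXOR.Encoding n, E.HidesXOR ∧ E.DecodesWithAverage p,
      ∃ P : QuantumXOR.OTProtocol n, P.IsOT p ∧ P.Secure s ∧ P.NonInteractive,
      ∃ P : QuantumXOR.OTProtocol n, P.IsOT p ∧ P.Secure s,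
      ∃ S : QuantumXOR.CHSHStrategy n, S.winProb = p ].TFAE ∧
    ((1 / 2 : ℝ) ^ n ≤ p →
      [ ∃ E : QuantumXOR.Encoding n, E.HidesXOR ∧ E.optimalAverage = p,
        ∃ P : QuantumXOR.OTProtocol n, P.IsOT p ∧ P.Secure s ∧ P.NonInteractive,
        ∃ P : QuantumXOR.OTProtocol n, P.IsOT p ∧ P.Secure s,
        ∃ S : QuantumXOR.CHSHStrategy n, S.winProb = p ].TFAE) := by
  have h14 : (∃ E : QuantumXOR.Encoding n, E.HidesXOR ∧ E.DecodesWithAverage p) →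
      ∃ S : QuantumXOR.CHSHStrategy n, S.winProb = p := by
    rintro ⟨E, hE, hp⟩
    exact QuantumXOR.exists_strategy_of_encoding E hE hp
  have h41 : (∃ S : QuantumXOR.CHSHStrategy n, S.winProb = p) →
      ∃ E : QuantumXOR.Encoding n, E.HidesXOR ∧ E.DecodesWithAverage p := by
    rintro ⟨S, rfl⟩
    exact QuantumXOR.exists_encoding_of_strategy S
  have h42 : (∃ S : QuantumXOR.CHSHStrategy n, S.winProb = p) →
      ∃ P : QuantumXOR.OTProtocol n, P.IsOT p ∧ P.Secure s ∧ P.NonInteractive := by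
    rintro ⟨S, rfl⟩
    exact ⟨S.protocol, S.protocol_isOT, S.protocol_secure s, S.protocol_nonInteractive⟩
  have h23 : (∃ P : QuantumXOR.OTProtocol n, P.IsOT p ∧ P.Secure s ∧ P.NonInteractive) →
      ∃ P : QuantumXOR.OTProtocol n, P.IsOT p ∧ P.Secure s := by
    rintro ⟨P, hP, hs, -⟩
    exact ⟨P, hP, hs⟩
  have h34 : (∃ P : QuantumXOR.OTProtocol n, P.IsOT p ∧ P.Secure s) →
      ∃ S : QuantumXOR.CHSHStrategy n, S.winProb = p := by
    rintro ⟨P, hP, hs⟩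
    exact QuantumXOR.exists_strategy_of_protocol P hP hs
  refine ⟨?_, fun hnp => ?_⟩
  · tfae_have 1 → 4 := h14
    tfae_have 4 → 1 := h41
    tfae_have 4 → 2 := h42
    tfae_have 2 → 3 := h23
    tfae_have 3 → 4 := h34
    tfae_finish
  · tfae_have 1 → 4 := by
      rintro ⟨E, hE, rfl⟩
      exact h14 ⟨E, hE, E.decodesWithAverage_optimalAverage⟩
    -- Only here is `p` required to be at least the blind guess, below which noise cannot bring the
    -- optimum.
    tfae_have 4 → 1 := by
      intro h
      obtain ⟨E, hE, hp⟩ := h41 h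
      exact E.exists_optimalAverage_eq hE hp hnp
    tfae_have 4 → 2 := h42
    tfae_have 2 → 3 := h23
    tfae_have 3 → 4 := h34
    tfae_finish
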